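/- Let $q$ be a prime power, let $A=\mathbb{F}_q[\theta]$ and $\mathsf{A}=\mathbb{F}_q[t]$, let $f\in A$ be monic and irreducible of degree $d$, and put $\mathbb{F}_f=A/fA$, made into an $\mathsf{A}$-field by $t\mapsto\bar\theta$ for a chosen root $\bar\theta\in\mathbb{F}_f$ of $f$. Let $\tau$ be the $q$-th power Frobenius and $\sigma=\tau^{-1}$. Let $E:\mathsf{A}\to \mathrm{Mat}_{\ell}(\mathbb{F}_f[\tau])$ be a $t$-module, i.e. an $\mathbb{F}_q$-algebra homomorphism such that the constant term of $E_t$ minus $\bar\theta\,\mathrm{I}_\ell$ is nilpotent. Assume that $E$ is abelian (the $t$-motive $\mathrm{Mat}_{1\times\ell}(\mathbb{F}_f[\tau])$, with $t$ acting by $m\mapsto mE_t$, is free of finite rank over $\mathbb{F}_f[t]$) and $\mathsf{A}$-finite (the dual $t$-motive $\mathrm{Mat}_{1\times\ell}(\mathbb{F}_f[\sigma])$, with $t$ acting by $n\mapsto nE_t^*$, is free of finite rank over $\mathbb{F}_f[t]$); here $E_t^*$ is the transpose of the matrix of the entries of $E_t$ under $\sum b_i\tau^i\mapsto\sum \sigma^i(b_i)\sigma^i$.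 Let $\lambda\in\mathsf{A}$ be monic and irreducible with $\lambda(\theta)\neq f$, let $\mathsf{A}_\lambda=\varprojlim\mathsf{A}/\lambda^m\mathsf{A}$, and let $T_\lambda(E)=\varprojlim E[\lambda^m]$, where $E[\lambda^m]$ is the $\lambda^m$-torsion of $E(\overline{\mathbb{F}}_f)$. Then $T_\lambda(E)$ is free of finite rank over $\mathsf{A}_\lambda$, the value $\mathrm{Char}(\tau^d,T_\lambda(E),1)$ at $X=1$ of the characteristic polynomial of $\tau^d$ on $T_\lambda(E)$ lies in $\mathsf{A}$, and \[ [E(\mathbb{F}_f)]_{\mathsf{A}}=\gamma\cdot \mathrm{Char}(\tau^d,T_\lambda(E),1), \] where $\gamma\in\mathbb{F}_q^\times$ is the unique constant that makes the right-hand side monic in $t$. Here, for a finitely generated torsion $\mathsf{A}$-module $M\cong\bigoplus_i\mathsf{A}/(g_i)$ with $g_i$ monic, $[M]_{\mathsf{A}}=\prod_i g_i$ is its $\mathsf{A}$-order. -/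

import Mathlib

open Polynomial

noncomputable section

/-! ### Frobenius operators and twisted polynomials -/

/-- The `q`-th power Frobenius operator `τ` on an `𝔽_q`-algebra. -/
abbrev tauHom (Fq : Type*) [Field Fq] [Fintype Fq] (R : Type*) [CommRing R] [Algebra Fq R] :
    R →ₐ[Fq] R :=
  FiniteField.frobeniusAlgHom Fq R

/-- The inverse `σ = τ⁻¹` of the `q`-th power Frobenius on an algebraic extension of `𝔽_q`. -/
abbrev sigmaHom (Fq : Type*) [Field Fq] [Fintype Fq] (F : Type*) [Field F] [Algebra Fq F]
    [Algebra.IsAlgebraic Fq F] : F →ₐ[Fq] F :=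
  ((FiniteField.frobeniusAlgEquivOfAlgebraic Fq F).symm : F →ₐ[Fq] F)

section Twisted

variable {k R : Type*} [CommRing k] [CommRing R] [Algebra k R]

/-- A copy of the `k`-algebra `R` on which the free monoid on one generator acts through the
powers of the endomorphism `φ`. -/
def Twist (_φ : R →ₐ[k] R) : Type _ := R

instance (φ : R →ₐ[k] R) : CommRing (Twist φ) := inferInstanceAs (CommRing R)

instance (φ : R →ₐ[k] R) : Algebra k (Twist φ) := inferInstanceAs (Algebra k R)

instance (φ : R →ₐ[k] R) : Module R (Twist φ) := inferInstanceAs (Module R R)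

/-- The identity map from `R` to its copy. -/
def toTwist (φ : R →ₐ[k] R) : R ≃ₐ[k] Twist φ := (AlgEquiv.refl : R ≃ₐ[k] R)

theorem smul_toTwist (φ : R →ₐ[k] R) (c b : R) : c • toTwist φ b = toTwist φ (c * b) := rfl

instance (φ : R →ₐ[k] R) : MulSemiringAction (Multiplicative ℕ) (Twist φ) where
  smul n x := toTwist φ ((φ ^ n.toAdd) ((toTwist φ).symm x))
  one_smul _ := rfl
  mul_smul m n x := by
    change toTwist φ ((φ ^ (m.toAdd + n.toAdd)) _) =
      toTwist φ ((φ ^ m.toAdd) ((φ ^ n.toAdd) _))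
    rw [pow_add]; rfl
  smul_zero n := map_zero (φ ^ n.toAdd)
  smul_add n := map_add (φ ^ n.toAdd)
  smul_one n := map_one (φ ^ n.toAdd)
  smul_mul n := map_mul (φ ^ n.toAdd)

theorem smul_twist_def (φ : R →ₐ[k] R) (n : Multiplicative ℕ) (b : R) :
    n • toTwist φ b = toTwist φ ((φ ^ n.toAdd) b) := rfl

instance (φ : R →ₐ[k] R) : SMulCommClass (Multiplicative ℕ) k (Twist φ) :=
  ⟨fun n c x => map_smul (φ ^ n.toAdd) c x⟩

/-- The ring `R[φ]` of twisted polynomials `∑ bᵢ φⁱ` with the relation `φ b = φ(b) φ`. It is a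
`k`-algebra, and `R` acts on it by multiplication of the coefficients, that is, by left
multiplication. -/
abbrev TwistedPoly (φ : R →ₐ[k] R) : Type _ := SkewPolynomial (Twist φ)

namespace TwistedPoly

/-- The monomial `b φⁿ`. -/
def monomial (φ : R →ₐ[k] R) (n : ℕ) (b : R) : TwistedPoly φ :=
  SkewMonoidAlgebra.single (Multiplicative.ofAdd n) (toTwist φ b)

/-- The coefficient of `φⁿ`. -/
def coeff {φ : R →ₐ[k] R} (p : TwistedPoly φ) (n : ℕ) : R :=
  (toTwist φ).symm (SkewPolynomial.coeff p n)

theorem monomial_mul_monomial (φ : R →ₐ[k] R) (m n : ℕ) (a b : R) :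
    monomial φ m a * monomial φ n b = monomial φ (m + n) (a * (φ ^ m) b) :=
  SkewMonoidAlgebra.single_mul_single

theorem smul_monomial (φ : R →ₐ[k] R) (n : ℕ) (c b : R) :
    c • monomial φ n b = monomial φ n (c * b) :=
  SkewMonoidAlgebra.smul_single c _ _

theorem induction {φ : R →ₐ[k] R} {P : TwistedPoly φ → Prop} (p : TwistedPoly φ) (zero : P 0)
    (mono : ∀ n b, P (monomial φ n b)) (add : ∀ p r, P p → P r → P (p + r)) : P p :=
  SkewMonoidAlgebra.induction_on p zero (fun n b => mono n.toAdd ((toTwist φ).symm b)) add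

theorem smul_eq_monomial_mul (φ : R →ₐ[k] R) (c : R) (p : TwistedPoly φ) :
    c • p = monomial φ 0 c * p := by
  induction p using TwistedPoly.induction with
  | zero => simp
  | mono n b => simp [smul_monomial, monomial_mul_monomial]
  | add p r hp hr => rw [smul_add, hp, hr, mul_add]

theorem smul_mul (φ : R →ₐ[k] R) (c : R) (p r : TwistedPoly φ) :
    (c • p) * r = c • (p * r) := by
  rw [smul_eq_monomial_mul, smul_eq_monomial_mul, mul_assoc]

end TwistedPoly

end Twisted

section Eval

variable (Fq : Type*) [Field Fq] [Fintype Fq] (F : Type*) [CommRing F] [Algebra Fq F]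
  (L : Type*) [CommRing L] [Algebra Fq L] [Algebra F L] [IsScalarTower Fq F L]

/-- Evaluation of twisted polynomials in `F[τ]` on an `F`-algebra `L`:
`∑ bᵢ τⁱ` acts by `x ↦ ∑ bᵢ x^(qⁱ)`. -/
def twistedEval : TwistedPoly (tauHom Fq F) →ₐ[Fq] Module.End Fq L :=
  SkewMonoidAlgebra.liftNCAlgHom
    (((Algebra.lmul Fq L).comp (IsScalarTower.toAlgHom Fq F L)).comp
      (toTwist (tauHom Fq F)).symm.toAlgHom)
    (powersHom (Module.End Fq L) (tauHom Fq L).toLinearMap)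
    (by
      intro (x : F) y
      ext z
      change algebraMap F L ((tauHom Fq F ^ y.toAdd) x) *
          ((tauHom Fq L).toLinearMap ^ y.toAdd) z =
        ((tauHom Fq L).toLinearMap ^ y.toAdd) (algebraMap F L x * z)
      simp [AlgHom.coe_pow, Module.End.coe_pow, FiniteField.coe_frobeniusAlgHom,
        pow_iterate, mul_pow])

theorem twistedEval_monomial (n : ℕ) (b : F) (x : L) :
    twistedEval Fq F L (TwistedPoly.monomial (tauHom Fq F) n b) x =
      algebraMap F L b * x ^ (Fintype.card Fq ^ n) := by
  have h : twistedEval Fq F L (TwistedPoly.monomial (tauHom Fq F) n b) =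
      Algebra.lmul Fq L (algebraMap F L b) * (tauHom Fq L).toLinearMap ^ n :=
    SkewMonoidAlgebra.liftNC_single _ _ _ _
  rw [h]
  simp [Module.End.coe_pow, FiniteField.coe_frobeniusAlgHom, pow_iterate]

end Eval

/-! ### Anderson `t`-modules -/

section TModules

variable {Fq : Type*} [Field Fq] [Fintype Fq] {F : Type*} [Field F] [Algebra Fq F]

/-- An Anderson `t`-module of dimension `ℓ` over the field `F`, where `F` is an `𝔽_q[t]`-field
through `t ↦ θ`: an `𝔽_q`-algebra homomorphism `E : 𝔽_q[t] → Mat_ℓ(F[τ])` such that `∂E_t - θ I`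
is nilpotent. -/
structure TModule (Fq : Type*) [Field Fq] [Fintype Fq] (F : Type*) [Field F] [Algebra Fq F]
    (θ : F) (ℓ : ℕ) where
  /-- The homomorphism `a ↦ E_a`. -/
  hom : Fq[X] →ₐ[Fq] Matrix (Fin ℓ) (Fin ℓ) (TwistedPoly (tauHom Fq F))
  /-- `∂E_t - θ I` is nilpotent. -/
  nilpotent : IsNilpotent
    ((hom X).map (fun b => TwistedPoly.coeff b 0) - Matrix.diagonal (fun _ => θ) : Matrix (Fin ℓ) (Fin ℓ) F)

/-- The map `(∑ bᵢ τⁱ)* = ∑ σⁱ(bᵢ) σⁱ` from `F[τ]` to `F[σ]`. -/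
def oreStar (Fq : Type*) [Field Fq] [Fintype Fq] {F : Type*} [Field F] [Algebra Fq F]
    [Algebra.IsAlgebraic Fq F] (p : TwistedPoly (tauHom Fq F)) : TwistedPoly (sigmaHom Fq F) :=
  ∑ n ∈ p.support, TwistedPoly.monomial (sigmaHom Fq F) n ((sigmaHom Fq F ^ n) (TwistedPoly.coeff p n))

/-- Right multiplication `m ↦ m B` on row vectors over a twisted polynomial ring, as a map that is
linear for the left multiplication by scalars. -/
def rowMul {φ : F →ₐ[Fq] F} {ℓ : ℕ} (B : Matrix (Fin ℓ) (Fin ℓ) (TwistedPoly φ)) :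
    (Fin ℓ → TwistedPoly φ) →ₗ[F] (Fin ℓ → TwistedPoly φ) where
  toFun m := Matrix.vecMul m B
  map_add' m n := Matrix.add_vecMul B m n
  map_smul' c m := by
    ext j
    simp only [Matrix.vecMul, dotProduct, Pi.smul_apply, RingHom.id_apply, Finset.smul_sum,
      TwistedPoly.smul_mul]

namespace TModule

variable {θ : F} {ℓ : ℕ} (E : TModule Fq F θ ℓ)

/-- The `t`-motive `Mat_{1×ℓ}(F[τ])`, with its structure of `F[t]`-module in which `t` acts by
`m ↦ m E_t`. -/
abbrev Motive : Type _ := Module.AEval' (rowMul (E.hom X))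

/-- `E` is abelian: its `t`-motive is free of finite rank over `F[t]`. -/
def IsAbelian : Prop := Module.Free F[X] E.Motive ∧ Module.Finite F[X] E.Motive

/-- The adjoint `E*_a = (E_a)*`, the transpose of the matrix of the images of the entries of `E_a`
in `F[σ]`. -/
def adjoint [Algebra.IsAlgebraic Fq F] (a : Fq[X]) :
    Matrix (Fin ℓ) (Fin ℓ) (TwistedPoly (sigmaHom Fq F)) :=
  ((E.hom a).map (oreStar Fq)).transpose

/-- The dual `t`-motive `Mat_{1×ℓ}(F[σ])`, with its structure of `F[t]`-module in which `t` acts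
by `n ↦ n E*_t`. -/
abbrev DualMotive [Algebra.IsAlgebraic Fq F] : Type _ := Module.AEval' (rowMul (E.adjoint X))

/-- `E` is `𝔽_q[t]`-finite: its dual `t`-motive is free of finite rank over `F[t]`. -/
def IsAFinite [Algebra.IsAlgebraic Fq F] : Prop :=
  Module.Free F[X] E.DualMotive ∧ Module.Finite F[X] E.DualMotive

section Points

variable (L : Type*) [CommRing L] [Algebra Fq L] [Algebra F L] [IsScalarTower Fq F L]

/-- The action of `𝔽_q[t]` on `L^ℓ` through `E`: `a` acts by `x ↦ E_a(x)`. -/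
def action : Fq[X] →ₐ[Fq] Module.End Fq (Fin ℓ → L) :=
  ((endVecAlgEquivMatrixEnd (Fin ℓ) Fq Fq L).symm.toAlgHom.comp
    (twistedEval Fq F L).mapMatrix).comp E.hom

theorem action_apply (a : Fq[X]) (x : Fin ℓ → L) (i : Fin ℓ) :
    E.action L a x i = ∑ j, twistedEval Fq F L (E.hom a i j) (x j) := rfl

/-- `E(L)`: the group `L^ℓ` with the `𝔽_q[t]`-module structure given by `E`. -/
def Points (_E : TModule Fq F θ ℓ) (L : Type*) : Type _ := Fin ℓ → L

instance : AddCommGroup (E.Points L) := inferInstanceAs (AddCommGroup (Fin ℓ → L))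

instance : Module Fq[X] (E.Points L) :=
  letI : Module (Module.End Fq (Fin ℓ → L)) (E.Points L) :=
    inferInstanceAs (Module (Module.End Fq (Fin ℓ → L)) (Fin ℓ → L))
  Module.compHom (E.Points L) (E.action L).toRingHom

variable {L}

theorem smul_points (a : Fq[X]) (x : E.Points L) : a • x = E.action L a x := rfl

theorem twistedEval_map (g : L →ₐ[F] L) (p : TwistedPoly (tauHom Fq F)) (x : L) :
    g (twistedEval Fq F L p x) = twistedEval Fq F L p (g x) := by
  induction p using TwistedPoly.induction with
  | zero => simp
  | mono n b => simp [twistedEval_monomial]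
  | add p r hp hr => simp [hp, hr]

/-- The `𝔽_q[t]`-linear map `E(L) → E(L)` induced on coordinates by an `F`-algebra
endomorphism of `L`. -/
def pointsMap (g : L →ₐ[F] L) : E.Points L →ₗ[Fq[X]] E.Points L where
  toFun x := fun i => g (x i)
  map_add' x y := funext fun i => map_add g (x i) (y i)
  map_smul' a x := by
    funext i
    change g (E.action L a x i) = E.action L a (fun j => g (x j)) i
    rw [action_apply E L a x i, map_sum, action_apply]
    exact Finset.sum_congr rfl fun j _ => twistedEval_map g _ _

end Points

end TModule

end TModules

/-! ### Tate modules -/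

section Tate

variable {A : Type*} [CommRing A] (lam : A) (M : Type*) [AddCommGroup M] [Module A M]

/-- The `λ`-adic completion `A_λ = lim A / λᵐ A`. -/
abbrev LamCompletion : Type _ := AdicCompletion (Ideal.span {lam}) A

/-- The `λᵐ`-torsion `M[λᵐ]` of `M`. -/
def LamTorsion (m : ℕ) : Type _ := Submodule.torsionBy A M (lam ^ m)

instance (m : ℕ) : AddCommGroup (LamTorsion lam M m) :=
  inferInstanceAs (AddCommGroup (Submodule.torsionBy A M (lam ^ m)))

instance (m : ℕ) : Module A (LamTorsion lam M m) :=
  inferInstanceAs (Module A (Submodule.torsionBy A M (lam ^ m)))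

theorem lamTorsion_isTorsionBySet (m : ℕ) :
    Module.IsTorsionBySet A (LamTorsion lam M m)
      ((Ideal.span {lam} ^ m : Ideal A) : Set A) := by
  rintro x ⟨a, ha⟩
  rw [Ideal.span_singleton_pow, SetLike.mem_coe, Ideal.mem_span_singleton] at ha
  obtain ⟨b, rfl⟩ := ha
  apply Subtype.ext
  change (lam ^ m * b) • (x.1 : M) = 0
  rw [mul_comm, mul_smul]
  exact (congrArg (b • ·) x.2).trans (smul_zero b)

/-- `A_λ` acts on `M[λᵐ]` through `A / λᵐ A`. -/
instance (m : ℕ) : Module (LamCompletion lam) (LamTorsion lam M m) :=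
  letI : Module (A ⧸ Ideal.span {lam} ^ m) (LamTorsion lam M m) :=
    (lamTorsion_isTorsionBySet lam M m).module
  Module.compHom _ (AdicCompletion.evalₐ (Ideal.span {lam}) m).toRingHom

theorem lamCompletion_smul (m : ℕ) (a : LamCompletion lam) (r : A)
    (h : AdicCompletion.evalₐ (Ideal.span {lam}) m a = Ideal.Quotient.mk _ r)
    (x : LamTorsion lam M m) : a • x = r • x := by
  let _ : Module (A ⧸ Ideal.span {lam} ^ m) (LamTorsion lam M m) :=
    (lamTorsion_isTorsionBySet lam M m).module
  change (AdicCompletion.evalₐ (Ideal.span {lam}) m a) • x = _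
  rw [h]
  exact Module.IsTorsionBySet.mk_smul (lamTorsion_isTorsionBySet lam M m) r x

/-- The `λ`-adic Tate module `T_λ(M) = lim M[λᵐ]`, along multiplication by `λ`, as an
`A_λ`-module. -/
def TateModule : Submodule (LamCompletion lam) (∀ m, LamTorsion lam M m) where
  carrier := {x | ∀ m, lam • (x (m + 1)).1 = (x m).1}
  zero_mem' m := smul_zero lam
  add_mem' {x y} hx hy m := by
    change lam • ((x (m + 1)).1 + (y (m + 1)).1) = (x m).1 + (y m).1
    rw [smul_add, hx m, hy m]
  smul_mem' a x hx m := by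
    obtain ⟨y, rfl⟩ := AdicCompletion.mk_surjective _ _ a
    have hr := AdicCompletion.evalₐ_mk (Ideal.span {lam}) (m + 1) y
    have hr' : AdicCompletion.evalₐ (Ideal.span {lam}) m (AdicCompletion.mk _ _ y) =
        Ideal.Quotient.mk _ (y.val (m + 1)) := by
      rw [AdicCompletion.evalₐ_mk, Ideal.Quotient.mk_eq_mk_iff_sub_mem]
      have h := SModEq.sub_mem.mp (y.2 (Nat.le_succ m))
      simpa using h
    have h1 := lamCompletion_smul lam M (m + 1) _ _ hr (x (m + 1))
    have h2 := lamCompletion_smul lam M m _ _ hr' (x m)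
    change lam • (AdicCompletion.mk _ _ y • x (m + 1)).1 = (AdicCompletion.mk _ _ y • x m).1
    rw [h1, h2]
    change lam • (y.val (m + 1) • (x (m + 1)).1) = y.val (m + 1) • (x m).1
    rw [smul_comm, hx m]

variable {M}

/-- The `A_λ`-linear endomorphism of `T_λ(M)` induced by an `A`-linear endomorphism of `M`. -/
def tateMap (g : M →ₗ[A] M) : TateModule lam M →ₗ[LamCompletion lam] TateModule lam M where
  toFun x := ⟨fun m => ⟨g (x.1 m).1, by
      change lam ^ m • g (x.1 m).1 = 0
      rw [← map_smul]
      exact (congrArg g (x.1 m).2).trans (map_zero g)⟩, fun m => by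
      change lam • g (x.1 (m + 1)).1 = g (x.1 m).1
      rw [← map_smul, x.2 m]⟩
  map_add' x y := by
    apply Subtype.ext; funext m; apply Subtype.ext
    exact map_add g (x.1 m).1 (y.1 m).1
  map_smul' a x := by
    apply Subtype.ext; funext m
    obtain ⟨r, hr⟩ := Ideal.Quotient.mk_surjective
      (AdicCompletion.evalₐ (Ideal.span {lam}) m a)
    refine Eq.trans ?_ (lamCompletion_smul lam M m a r hr.symm _).symm
    apply Subtype.ext
    change g (a • x.1 m).1 = r • g (x.1 m).1
    rw [lamCompletion_smul lam M m a r hr.symm (x.1 m), ← map_smul]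
    rfl

end Tate

/-! ### Orders of finite modules over a polynomial ring -/

/-- `h` is the `k[t]`-order of the `k[t]`-module `M`: there are monic polynomials
`g₁, …, gₙ` with `M ≅ k[t]/(g₁) ⊕ ⋯ ⊕ k[t]/(gₙ)` and `h = g₁ ⋯ gₙ`. -/
def IsModuleOrder {k : Type*} [Field k] (M : Type*) [AddCommGroup M] [Module k[X] M]
    (h : k[X]) : Prop :=
  ∃ (n : ℕ) (g : Fin n → k[X]), (∀ i, (g i).Monic) ∧
    Nonempty (M ≃ₗ[k[X]] ∀ i, k[X] ⧸ Ideal.span {g i}) ∧ h = ∏ i, g i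

/-! ### Frobenius for `t`-modules over `𝔽_f` -/

section FiniteChar

variable {Fq : Type*} [Field Fq] [Fintype Fq] (f : Fq[X]) [Fact (Irreducible f)]

instance adjoinRoot_finite : FiniteDimensional Fq (AdjoinRoot f) :=
  (AdjoinRoot.powerBasis (Fact.out : Irreducible f).ne_zero).finite

/-- With `d = deg f`, the operator `τ^d` on an algebraic closure of `𝔽_f = 𝔽_q[θ]/(f)`, which is
linear over `𝔽_f`. -/
def frobF : AlgebraicClosure (AdjoinRoot f) →ₐ[AdjoinRoot f] AlgebraicClosure (AdjoinRoot f) :=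
  { (tauHom Fq (AlgebraicClosure (AdjoinRoot f)) ^ f.natDegree).toRingHom with
    commutes' := fun c => by
      have hfin : Module.finrank Fq (AdjoinRoot f) = f.natDegree := by
        rw [(AdjoinRoot.powerBasis (Fact.out : Irreducible f).ne_zero).finrank,
          AdjoinRoot.powerBasis_dim]
      have : Finite (AdjoinRoot f) := Module.finite_of_finite Fq
      have h : tauHom Fq (AdjoinRoot f) ^ f.natDegree = 1 := by
        rw [← hfin, ← FiniteField.orderOf_frobeniusAlgHom, pow_orderOf_eq_one]
      have h2 : c ^ (Fintype.card Fq ^ f.natDegree) = c := by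
        have := DFunLike.congr_fun h c
        simpa [AlgHom.coe_pow, FiniteField.coe_frobeniusAlgHom, pow_iterate] using this
      change (tauHom Fq (AlgebraicClosure (AdjoinRoot f)) ^ f.natDegree) _ = _
      rw [AlgHom.coe_pow, FiniteField.coe_frobeniusAlgHom, pow_iterate]
      change (algebraMap _ _ c) ^ _ = _
      rw [← map_pow, h2] }

variable {f} {θ : AdjoinRoot f} {ℓ : ℕ}

/-- The Tate module `T_λ(E) = lim E[λᵐ]` of a `t`-module over `𝔽_f`, where `E[λᵐ]` is the
`λᵐ`-torsion of `E` over an algebraic closure of `𝔽_f`. -/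
abbrev TModule.Tate (E : TModule Fq (AdjoinRoot f) θ ℓ) (lam : Fq[X]) :
    Submodule (LamCompletion lam) (∀ m, LamTorsion lam
      (E.Points (AlgebraicClosure (AdjoinRoot f))) m) :=
  TateModule lam (E.Points (AlgebraicClosure (AdjoinRoot f)))

/-- The endomorphism `τ^d` of `T_λ(E)`. -/
def TModule.tateFrob (E : TModule Fq (AdjoinRoot f) θ ℓ) (lam : Fq[X]) :
    E.Tate lam →ₗ[LamCompletion lam] E.Tate lam :=
  tateMap lam (E.pointsMap (frobF f))

end FiniteChar

end

/-! Let `F` be the finite base field, of degree `d` over `𝔽_q`, and let `N` be the dual `t`-motive,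
free of some rank `r` over `F[t]`. For an algebraic extension `L` of `F` put `N_L = L ⊗ N`, in
coordinates `L[t]^r`, on which `σ` acts semilinearly by `w ↦ Φ w^(σ)`. Since `b σ^i = σ^i τ^i(b)`,
the map `∑ bᵢ σ^i ↦ ∑ τ^i(bᵢ)` identifies `N_L/(σ-1)N_L` with `E(L)`, compatibly with `𝔽_q[t]`
(`toPoints_surjective`, `toPoints_eq_zero_iff`, `toPoints_base_smul`), and `σ-1` is injective on
`N_L` (`sigmaVec_fixed_eq_zero`). Both sides of the formula are compared with `det(1-σ^d)` on `N`,
where `σ^d` is `F[t]`-linear.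

Rational points: the trace `1+σ+⋯+σ^(d-1)` induces `F ⊗ E(F) ≅ N/(1-σ^d)N` (`exists_tensor_equiv`).
By Smith normal form, `det(1-σ^d)` is therefore the order of `E(F)` up to a factor in `F^×`
(`associated_det_oneSubMatrix`).

Torsion: if `μx = 0` and `y` lifts `x`, then `μy = σw - w` for some `w`, unique modulo `μ`; this
gives `E[μ] ≅ (N_L/μ)^σ` (`Represents`). Nilpotency of `∂E_t - θ` makes `σ` bijective on `N/λ` when
`λ(θ) ≠ 0`, so over an algebraically closed `L` Lang's theorem applies (`span_sigmaMod_fixed`):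
`N_L/λ` is spanned by its fixed vectors and `σ-1` is onto. Hence `E[λ]` has rank `r` over `A/λ`,
`E(L)` is `λ`-divisible, and `T_λ(E)` is free of rank `r`.

Comparison: a fixed vector `w` modulo `λ^m` satisfies `Ψw ≡ w^(τ^d)`, where `Ψ` is the matrix of
`σ^d`. So `Ψ` is conjugate modulo `λ^m` to the matrix of `τ^d` on `E[λ^m]` (`pow_dvd_det_sub_det`).
Thus a constant multiple of the order of `E(F)` is congruent modulo every `λ^m` to a polynomial over
`𝔽_q`; the constant then lies in `𝔽_q` (`exists_algebraMap_eq_of_pow_dvd`), and passing to the limit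
gives the formula. -/

set_option linter.unusedSectionVars false

noncomputable section


/-! ### Orders of finite-dimensional modules over `k[X]` -/

section Order

open Module

/-- Multiplication by the variable, as a `k`-linear endomorphism of a `k[X]`-module. -/
def xEnd (k : Type*) [Field k] (M : Type*) [AddCommGroup M] [Module k[X] M] [Module k M]
    [IsScalarTower k k[X] M] : M →ₗ[k] M where
  toFun m := (X : k[X]) • m
  map_add' := smul_add _
  map_smul' c m := by
    rw [RingHom.id_apply, ← IsScalarTower.algebraMap_smul k[X] c m,
      ← IsScalarTower.algebraMap_smul k[X] c ((X : k[X]) • m), smul_comm]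

variable {k : Type*} [Field k]

section

variable {M N : Type*} [AddCommGroup M] [Module k[X] M] [Module k M] [IsScalarTower k k[X] M]
  [AddCommGroup N] [Module k[X] N] [Module k N] [IsScalarTower k k[X] N]

theorem charpoly_xEnd_congr [FiniteDimensional k M] [FiniteDimensional k N] (e : M ≃ₗ[k[X]] N) :
    (xEnd k M).charpoly = (xEnd k N).charpoly := by
  rw [← LinearEquiv.charpoly_conj (e.restrictScalars k) (xEnd k M)]
  congr 1
  ext n
  change e ((X : k[X]) • e.symm n) = (X : k[X]) • n
  rw [map_smul, e.apply_symm_apply]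

theorem aeval_xEnd_apply (p : k[X]) (m : M) : aeval (xEnd k M) p m = p • m := by
  induction p using Polynomial.induction_on' with
  | add p q hp hq => rw [map_add, LinearMap.add_apply, hp, hq, add_smul]
  | monomial n a =>
    rw [aeval_monomial, ← C_mul_X_pow_eq_monomial, mul_smul,
      ← Polynomial.algebraMap_eq, IsScalarTower.algebraMap_smul]
    change a • ((xEnd k M ^ n) m) = _
    congr 1
    induction n with
    | zero => simp
    | succ n ih => rw [pow_succ', pow_succ', mul_smul, ← ih]; rfl

theorem charpoly_xEnd_smul [FiniteDimensional k M] (m : M) : (xEnd k M).charpoly • m = 0 := by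
  rw [← aeval_xEnd_apply, LinearMap.aeval_self_charpoly, LinearMap.zero_apply]

theorem charpoly_xEnd_prod [FiniteDimensional k M] [FiniteDimensional k N] :
    (xEnd k (M × N)).charpoly = (xEnd k M).charpoly * (xEnd k N).charpoly :=
  LinearMap.charpoly_prodMap (xEnd k M) (xEnd k N)

theorem charpoly_xEnd_of_baseChange {K : Type*} [Field K] [Algebra k K] [FiniteDimensional k M]
    {Q : Type*} [AddCommGroup Q] [Module K[X] Q] [Module K Q] [IsScalarTower K K[X] Q]
    [FiniteDimensional K Q] (Θ : TensorProduct k K M ≃ₗ[K] Q)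
    (hΘ : ∀ ξ, Θ ((xEnd k M).baseChange K ξ) = xEnd K Q (Θ ξ)) :
    (xEnd K Q).charpoly = (xEnd k M).charpoly.map (algebraMap k K) := by
  rw [← LinearMap.charpoly_baseChange, ← LinearEquiv.charpoly_conj Θ]
  congr 1
  ext q
  rw [LinearEquiv.conj_apply]
  change _ = Θ ((xEnd k M).baseChange K (Θ.symm q))
  rw [hΘ, LinearEquiv.apply_symm_apply]

end

theorem finiteDimensional_quotient_span {g : k[X]} (hg : g ≠ 0) :
    FiniteDimensional k (k[X] ⧸ Ideal.span {g}) :=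
  (AdjoinRoot.powerBasis hg).finite

theorem charpoly_xEnd_quotient {g : k[X]} (hg : g.Monic)
    [FiniteDimensional k (k[X] ⧸ Ideal.span {g})] :
    (xEnd k (k[X] ⧸ Ideal.span {g})).charpoly = g := by
  let pb := AdjoinRoot.powerBasis hg.ne_zero
  have h := charpoly_leftMulMatrix pb
  rw [AdjoinRoot.powerBasis_gen, AdjoinRoot.minpoly_root hg.ne_zero, hg.leadingCoeff, inv_one,
    C_1, mul_one] at h
  rw [← LinearMap.charpoly_toMatrix (xEnd k (k[X] ⧸ Ideal.span {g})) pb.basis]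
  exact h

theorem charpoly_xEnd_pi_quotient {n : ℕ} (g : Fin n → k[X]) (hg : ∀ i, (g i).Monic)
    [hfin : ∀ i, FiniteDimensional k (k[X] ⧸ Ideal.span {g i})] :
    (xEnd k (∀ i, k[X] ⧸ Ideal.span {g i})).charpoly = ∏ i, g i := by
  induction n with
  | zero =>
    rw [Fin.prod_univ_zero]
    rw [← Polynomial.Monic.natDegree_eq_zero (LinearMap.charpoly_monic _), LinearMap.charpoly_natDegree]
    exact Module.finrank_zero_of_subsingleton
  | succ n ih =>
    rw [charpoly_xEnd_congr (Fin.consLinearEquiv k[X] fun i => k[X] ⧸ Ideal.span {g i}).symm,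
      charpoly_xEnd_prod, charpoly_xEnd_quotient (hg 0), Fin.prod_univ_succ]
    congr 1
    exact ih (fun i => g i.succ) (fun i => hg i.succ) (hfin := fun i => hfin i.succ)

/-- Multiplication by the variable on `k[X]/(g)` has characteristic polynomial `g`, and
characteristic polynomials multiply over direct sums. In particular the order is unique. -/
theorem IsModuleOrder.eq_charpoly {M : Type*} [AddCommGroup M] [Module k[X] M] [Module k M]
    [IsScalarTower k k[X] M] [FiniteDimensional k M] {h : k[X]} (hM : IsModuleOrder M h) :
    h = (xEnd k M).charpoly := by
  obtain ⟨n, g, hg, ⟨e⟩, rfl⟩ := hM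
  have hfin : ∀ i, FiniteDimensional k (k[X] ⧸ Ideal.span {g i}) := fun i =>
    finiteDimensional_quotient_span (hg i).ne_zero
  rw [charpoly_xEnd_congr e, charpoly_xEnd_pi_quotient g hg]

theorem exists_monic_span_eq {g : k[X]} (hg : g ≠ 0) :
    ∃ g' : k[X], g'.Monic ∧ Ideal.span {g} = Ideal.span {g'} ∧ Associated g g' := by
  classical
  exact ⟨normalize g, monic_normalize hg, Ideal.span_singleton_eq_span_singleton.mpr
    (associated_normalize g), associated_normalize g⟩

theorem isModuleOrder_of_equiv {M : Type*} [AddCommGroup M] [Module k[X] M] {ι : Type*}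
    [Fintype ι] (g : ι → k[X]) (hg : ∀ i, g i ≠ 0)
    (e : M ≃ₗ[k[X]] ∀ i, k[X] ⧸ Ideal.span {g i}) :
    ∃ h, IsModuleOrder M h ∧ Associated (∏ i, g i) h := by
  choose g' hm hs ha using fun i => exists_monic_span_eq (hg i)
  let σ := (Fintype.equivFin ι).symm
  refine ⟨∏ i, g' i, ⟨Fintype.card ι, fun i => g' (σ i), fun i => hm _, ⟨?_⟩, ?_⟩, ?_⟩
  · exact e.trans ((LinearEquiv.piCongrRight fun i => Submodule.quotEquivOfEq _ _ (hs i)).trans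
      (LinearEquiv.piCongrLeft k[X] (fun i => k[X] ⧸ Ideal.span {g' i}) σ).symm)
  · exact (Equiv.prod_comp σ g').symm
  · exact Associated.prod _ _ _ fun i _ => ha i

/-- By Cayley–Hamilton the module is torsion, so the structure theorem supplies some order;
uniqueness says which one. -/
theorem isModuleOrder_charpoly (M : Type*) [AddCommGroup M] [Module k[X] M] [Module k M]
    [IsScalarTower k k[X] M] [FiniteDimensional k M] :
    IsModuleOrder M (xEnd k M).charpoly := by
  have hfin : Module.Finite k[X] M := Module.Finite.of_restrictScalars_finite k k[X] M
  have htors : Module.IsTorsion k[X] M := fun {m} => by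
    refine ⟨⟨(xEnd k M).charpoly, mem_nonZeroDivisors_of_ne_zero
      (LinearMap.charpoly_monic _).ne_zero⟩, ?_⟩
    exact charpoly_xEnd_smul m
  obtain ⟨ι, _, p, hp, e, ⟨eq⟩⟩ := Module.equiv_directSum_of_isTorsion htors
  classical
  obtain ⟨h, hh, -⟩ := isModuleOrder_of_equiv (fun i => p i ^ e i)
    (fun i => pow_ne_zero _ (hp i).ne_zero)
    (eq.trans (DirectSum.linearEquivFunOnFintype k[X] ι fun i => k[X] ⧸ k[X] ∙ p i ^ e i))
  rwa [hh.eq_charpoly] at hh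

/-- The characteristic polynomial `χ` of the variable kills the cokernel, so `S W = χ · 1` for some
`W`, and `χ` is monic. -/
theorem det_ne_zero_of_finite_quotient {r : ℕ} (S : Matrix (Fin r) (Fin r) k[X])
    [FiniteDimensional k ((Fin r → k[X]) ⧸ LinearMap.range S.mulVecLin)] : S.det ≠ 0 := by
  let χ := (xEnd k ((Fin r → k[X]) ⧸ LinearMap.range S.mulVecLin)).charpoly
  have hmem : ∀ v : Fin r → k[X], ∃ w, S.mulVec w = χ • v := fun v => by
    have h := charpoly_xEnd_smul (k := k) (Submodule.Quotient.mk v :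
      (Fin r → k[X]) ⧸ LinearMap.range S.mulVecLin)
    rw [← Submodule.Quotient.mk_smul, Submodule.Quotient.mk_eq_zero] at h
    exact h
  choose w hw using fun j : Fin r => hmem (Pi.single j 1)
  have hmul : S * Matrix.of (fun i j => w j i) = Matrix.diagonal fun _ => χ := by
    ext1 i j
    have h := congrFun (hw j) i
    rw [Pi.smul_apply, smul_eq_mul] at h
    refine Eq.trans h ?_
    by_cases hij : i = j
    · subst hij; rw [Pi.single_eq_same, Matrix.diagonal_apply_eq, mul_one]
    · rw [Pi.single_eq_of_ne hij, Matrix.diagonal_apply_ne _ hij, mul_zero]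
  intro h0
  have h := congrArg Matrix.det hmul
  rw [Matrix.det_mul, h0, zero_mul, Matrix.det_diagonal, Finset.prod_const] at h
  exact pow_ne_zero _ (LinearMap.charpoly_monic _).ne_zero h.symm

/-- The determinant of a square matrix over `k[X]` is, up to a unit, the characteristic
polynomial of the variable on its cokernel. -/
theorem associated_det_charpoly_quotient {r : ℕ} (S : Matrix (Fin r) (Fin r) k[X])
    [FiniteDimensional k ((Fin r → k[X]) ⧸ LinearMap.range S.mulVecLin)] :
    Associated S.det (xEnd k ((Fin r → k[X]) ⧸ LinearMap.range S.mulVecLin)).charpoly := by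
  let b := Pi.basisFun k[X] (Fin r)
  have hinj : Function.Injective S.mulVecLin := by
    rw [← LinearMap.ker_eq_bot, LinearMap.ker_eq_bot']
    intro v hv
    by_contra h
    exact det_ne_zero_of_finite_quotient S (Matrix.exists_mulVec_eq_zero_iff.mp ⟨v, h, hv⟩)
  let E := LinearEquiv.ofInjective S.mulVecLin hinj
  have hrank : Module.finrank k[X] (LinearMap.range S.mulVecLin) =
      Module.finrank k[X] (Fin r → k[X]) := E.symm.finrank_eq
  obtain ⟨h, hh, ha⟩ := isModuleOrder_of_equiv _
    (Submodule.smithNormalFormCoeffs_ne_zero b hrank)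
    (Submodule.quotientEquivPiSpan (LinearMap.range S.mulVecLin) b hrank)
  rw [← hh.eq_charpoly]
  refine Associated.trans ?_ ha
  let a := Submodule.smithNormalFormCoeffs b hrank
  let b' := Submodule.smithNormalFormTopBasis b hrank
  let ab := Submodule.smithNormalFormBotBasis b hrank
  have ab_eq := Submodule.smithNormalFormBotBasis_def b hrank
  let e' := b'.equiv ab (Equiv.refl _)
  have h1 : Associated (LinearMap.det S.mulVecLin)
      (LinearMap.det ((LinearMap.range S.mulVecLin).subtype ∘ₗ (e' : (Fin r → k[X]) →ₗ[k[X]] _))) :=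
    LinearMap.associated_det_comp_equiv (LinearMap.range S.mulVecLin).subtype E e'
  have h2 : LinearMap.det S.mulVecLin = S.det := LinearMap.det_toLin' S
  rw [h2] at h1
  -- `S` and the inclusion of its range precomposed with `e'` differ by an automorphism; in the
  -- basis `b'` the latter is diagonal, with the Smith coefficients as entries.
  convert h1 using 1
  rw [← Matrix.det_diagonal, ← LinearMap.det_toLin b']
  congr 1
  refine b'.ext fun i => ?_
  rw [Matrix.toLin_self]
  simp only [LinearMap.comp_apply, LinearEquiv.coe_coe, e', b'.equiv_apply, Equiv.refl_apply,
    Submodule.subtype_apply]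
  rw [ab_eq i, Finset.sum_eq_single i (fun j _ hj => by rw [Matrix.diagonal_apply_ne _ hj, zero_smul])
    (by simp), Matrix.diagonal_apply_eq]

end Order


/-! ### Freeness of Tate modules -/

section TateFree

open Module

variable {A : Type*} [CommRing A] {lam : A} {M : Type*} [AddCommGroup M] [Module A M]

theorem exists_evalₐ_eq_mk (m : ℕ) (c : LamCompletion lam) :
    ∃ a : A, AdicCompletion.evalₐ (Ideal.span {lam}) m c = Ideal.Quotient.mk _ a :=
  (Ideal.Quotient.mk_surjective (AdicCompletion.evalₐ (Ideal.span {lam}) m c)).imp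
    fun _ h => h.symm

theorem pow_smul_tate (y : TateModule lam M) (m k : ℕ) :
    lam ^ k • (y.1 (m + k)).1 = (y.1 m).1 := by
  induction k with
  | zero => simp
  | succ k ih => rw [pow_succ, mul_smul, ← add_assoc, y.2 (m + k), ih]

/-- A divisible sequence starting at `x` gives an element of the Tate module. -/
theorem exists_tate_lift (hdiv : ∀ z : M, ∃ z', lam • z' = z) {x : M} (hx : lam • x = 0) :
    ∃ y : TateModule lam M, (y.1 1).1 = x := by
  choose g hg using hdiv
  let z : ℕ → M := fun n => g^[n] x
  have hz : ∀ n, lam • z (n + 1) = z n := fun n => by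
    simp only [z, Function.iterate_succ_apply', hg]
  -- `M[λ⁰]` is zero, so the sequence starts with `0` and `x` sits at index `1`.
  let y : ℕ → M := fun m => Nat.casesOn m 0 z
  have hy : ∀ m, lam • y (m + 1) = y m := fun m => by
    cases m with
    | zero => exact hx
    | succ n => exact hz n
  have hyt : ∀ m, lam ^ m • y m = 0 := fun m => by
    induction m with
    | zero => simp [y]
    | succ n ih => rw [pow_succ, mul_smul, hy, ih]
  exact ⟨⟨fun m => ⟨y m, hyt m⟩, hy⟩, rfl⟩

/-- A family of elements of `M[λ]` which is a basis over `A/λA`. -/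
structure IsTorsionBasis {ι : Type*} [Fintype ι] (lam : A) (x : ι → M) : Prop where
  torsion : ∀ j, lam • x j = 0
  dvd : ∀ a : ι → A, ∑ j, a j • x j = 0 → ∀ j, lam ∣ a j
  span : ∀ z : M, lam • z = 0 → ∃ a : ι → A, z = ∑ j, a j • x j

variable {ι : Type*} [Fintype ι]

/-- Multiplying a relation at level `m+1` by `λ^m` brings it to level `1`, so `a = λb`; since `λ`
lowers the level of `y` by one, `b` is a relation at level `m`. -/
theorem IsTorsionBasis.pow_dvd {x : ι → M}
    (hx : IsTorsionBasis lam x) (y : ι → TateModule lam M) (hy : ∀ j, ((y j).1 1).1 = x j)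
    (m : ℕ) (a : ι → A) (ha : ∑ j, a j • ((y j).1 m).1 = 0) (j : ι) : lam ^ m ∣ a j := by
  induction m generalizing a with
  | zero => simp
  | succ m ih =>
    have h1 : ∑ j, a j • x j = 0 := by
      have h2 := congrArg (lam ^ m • ·) ha
      simp only [smul_zero, Finset.smul_sum] at h2
      rw [← h2]
      refine Finset.sum_congr rfl fun j _ => ?_
      rw [smul_comm, add_comm m 1, pow_smul_tate, hy]
    choose b hb using hx.dvd a h1
    have h3 : ∑ j, b j • ((y j).1 m).1 = 0 := by
      rw [← ha]
      refine Finset.sum_congr rfl fun j _ => ?_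
      rw [hb j, mul_comm, mul_smul, (y j).2 m]
    rw [hb j, pow_succ']
    exact mul_dvd_mul_left _ (ih b h3)

/-- Successive approximation: coefficients matching `λ^m z` at level `1` leave a remainder in
`M[λ^m]`. -/
theorem IsTorsionBasis.exists_eq_sum {x : ι → M}
    (hx : IsTorsionBasis lam x) (y : ι → TateModule lam M) (hy : ∀ j, ((y j).1 1).1 = x j)
    (m : ℕ) (z : M) (hz : lam ^ m • z = 0) :
    ∃ a : ι → A, z = ∑ j, a j • ((y j).1 m).1 := by
  induction m generalizing z with
  | zero => exact ⟨0, by simpa using hz⟩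
  | succ m ih =>
    obtain ⟨a, ha⟩ := hx.span (lam ^ m • z) (by rw [← mul_smul, ← pow_succ', hz])
    obtain ⟨b, hb⟩ := ih (z - ∑ j, a j • ((y j).1 (m + 1)).1) (by
      rw [smul_sub, ha, sub_eq_zero, Finset.smul_sum]
      refine Finset.sum_congr rfl fun j _ => ?_
      rw [smul_comm, add_comm m 1, pow_smul_tate, hy])
    refine ⟨fun j => a j + b j * lam, ?_⟩
    rw [sub_eq_iff_eq_add] at hb
    rw [hb, add_comm, ← Finset.sum_add_distrib]
    refine Finset.sum_congr rfl fun j _ => ?_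
    rw [add_smul, mul_smul, (y j).2 m]

theorem tate_sum_smul_apply (y : ι → TateModule lam M) (c : ι → LamCompletion lam) (m : ℕ)
    (a : ι → A)
    (ha : ∀ j, AdicCompletion.evalₐ (Ideal.span {lam}) m (c j) = Ideal.Quotient.mk _ (a j)) :
    ((∑ j, c j • y j).1 m).1 = ∑ j, a j • ((y j).1 m).1 := by
  have h : (∑ j, c j • y j).1 m = ∑ j, a j • (y j).1 m := by
    rw [Submodule.coe_sum, Finset.sum_apply]
    exact Finset.sum_congr rfl fun j _ => lamCompletion_smul lam M m _ _ (ha j) _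
  rw [h]
  exact map_sum (Submodule.torsionBy A M (lam ^ m)).subtype _ _

theorem lamCompletion_ext {c c' : LamCompletion lam}
    (h : ∀ m, AdicCompletion.evalₐ (Ideal.span {lam}) m c =
      AdicCompletion.evalₐ (Ideal.span {lam}) m c') : c = c' :=
  AdicCompletion.ext_evalₐ h

theorem exists_lamCompletion (a : ℕ → A) (ha : ∀ m, lam ^ m ∣ a (m + 1) - a m) :
    ∃ c : LamCompletion lam,
      ∀ m, AdicCompletion.evalₐ (Ideal.span {lam}) m c = Ideal.Quotient.mk _ (a m) := by
  refine ⟨AdicCompletion.mk _ _ (AdicCompletion.AdicCauchySequence.mk (Ideal.span {lam}) A a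
    fun m => ?_), fun m => AdicCompletion.evalₐ_mk _ _ _⟩
  rw [SModEq.comm, SModEq.sub_mem, smul_eq_mul, Ideal.mul_top, Ideal.span_singleton_pow,
    Ideal.mem_span_singleton]
  exact ha m

/-- If `M` is `λ`-divisible and `M[λ]` is free over `A/λA`, then the Tate module is free over the
completion. -/
theorem IsTorsionBasis.exists_basis {x : ι → M}
    (hx : IsTorsionBasis lam x) (hdiv : ∀ z : M, ∃ z', lam • z' = z) :
    ∃ b : Basis ι (LamCompletion lam) (TateModule lam M), ∀ j, ((b j).1 1).1 = x j := by
  choose y hy using fun j => exists_tate_lift hdiv (hx.torsion j)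
  have hli : LinearIndependent (LamCompletion lam) y := by
    rw [Fintype.linearIndependent_iff]
    intro c hc j
    refine lamCompletion_ext fun m => ?_
    choose a ha using fun j => exists_evalₐ_eq_mk m (c j)
    have h := tate_sum_smul_apply y c m a ha
    rw [hc] at h
    rw [ha j, map_zero, Ideal.Quotient.eq_zero_iff_mem, Ideal.span_singleton_pow,
      Ideal.mem_span_singleton]
    exact hx.pow_dvd y hy m a h.symm j
  have hsp : ⊤ ≤ Submodule.span (LamCompletion lam) (Set.range y) := by
    rintro z -
    choose a ha using fun m => hx.exists_eq_sum y hy m (z.1 m).1 (z.1 m).2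
    -- Coordinates at level `m` are unique modulo `λ^m`, so those chosen independently at each level
    -- are compatible.
    have hcauchy : ∀ m j, lam ^ m ∣ a (m + 1) j - a m j := fun m j => by
      refine hx.pow_dvd y hy m (fun j => a (m + 1) j - a m j) ?_ j
      simp only [sub_smul, Finset.sum_sub_distrib]
      rw [← ha m, ← z.2 m, ha (m + 1), Finset.smul_sum, sub_eq_zero]
      refine Finset.sum_congr rfl fun j _ => ?_
      rw [smul_comm, (y j).2 m]
    choose c hc using fun j => exists_lamCompletion (fun m => a m j) fun m => hcauchy m j
    have hz : z = ∑ j, c j • y j := by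
      apply Subtype.ext
      funext m
      apply Subtype.ext
      rw [tate_sum_smul_apply y c m (a m) fun j => hc j m]
      exact ha m
    rw [hz]
    exact Submodule.sum_mem _ fun j _ =>
      Submodule.smul_mem _ _ (Submodule.subset_span ⟨j, rfl⟩)
  exact ⟨Basis.mk hli hsp, fun j => by rw [Basis.mk_apply]; exact hy j⟩

end TateFree


/-! ### Semilinear descent along the Frobenius -/

section Descent

variable {Fq : Type*} [Field Fq] [Fintype Fq] {L : Type*} [Field L] [Algebra Fq L]

/-- The `q` elements of `𝔽_q` already exhaust the roots of `X^q - X`. -/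
theorem mem_range_algebraMap_of_pow_card_eq {c : L} (hc : c ^ Fintype.card Fq = c) :
    ∃ a : Fq, algebraMap Fq L a = c := by
  classical
  by_contra h
  push Not at h
  have h1 : 1 < Fintype.card Fq := Fintype.one_lt_card
  let s : Finset L := insert c (Finset.univ.image (algebraMap Fq L))
  have hs : s.card = Fintype.card Fq + 1 := by
    rw [Finset.card_insert_of_notMem (by simpa using h),
      Finset.card_image_of_injective _ (algebraMap Fq L).injective, Finset.card_univ]
  have hne : (X ^ Fintype.card Fq - X : L[X]) ≠ 0 := FiniteField.X_pow_card_sub_X_ne_zero L h1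
  have hsub : s.val ≤ (X ^ Fintype.card Fq - X : L[X]).roots := by
    rw [Finset.val_le_iff_val_subset]
    intro x hx
    rw [mem_roots hne, IsRoot, eval_sub, eval_pow, eval_X, sub_eq_zero]
    rw [Finset.mem_val, Finset.mem_insert, Finset.mem_image] at hx
    rcases hx with rfl | ⟨a, -, rfl⟩
    · exact hc
    · rw [← map_pow, FiniteField.pow_card]
  have := (Multiset.card_le_card hsub).trans (card_roots' _)
  rw [FiniteField.X_pow_card_sub_X_natDegree_eq L h1] at this
  change s.card ≤ _ at this
  omega

section Sigma

variable [Algebra.IsAlgebraic Fq L]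

theorem sigmaHom_pow_card (x : L) : sigmaHom Fq L x ^ Fintype.card Fq = x :=
  (FiniteField.frobeniusAlgEquivOfAlgebraic Fq L).apply_symm_apply x

theorem sigmaHom_pow_card' (x : L) : sigmaHom Fq L (x ^ Fintype.card Fq) = x :=
  (FiniteField.frobeniusAlgEquivOfAlgebraic Fq L).symm_apply_apply x

theorem sigmaHom_injective : Function.Injective (sigmaHom Fq L) :=
  (sigmaHom Fq L).toRingHom.injective

theorem mem_range_algebraMap_of_sigmaHom_eq {c : L} (hc : sigmaHom Fq L c = c) :
    ∃ a : Fq, algebraMap Fq L a = c :=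
  mem_range_algebraMap_of_pow_card_eq (by nth_rw 1 [← hc]; exact sigmaHom_pow_card c)

theorem sigmaHom_algebraMap {K : Type*} [Field K] [Algebra Fq K] [Algebra.IsAlgebraic Fq K]
    (g : K →ₐ[Fq] L) (x : K) : sigmaHom Fq L (g x) = g (sigmaHom Fq K x) := by
  nth_rw 1 [← sigmaHom_pow_card (Fq := Fq) x]
  rw [map_pow, sigmaHom_pow_card']

theorem sigmaHom_iterate_algebraMap {K : Type*} [Field K] [Algebra Fq K]
    [Algebra.IsAlgebraic Fq K] (g : K →ₐ[Fq] L) (n : ℕ) (x : K) :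
    (sigmaHom Fq L)^[n] (g x) = g ((sigmaHom Fq K)^[n] x) := by
  induction n generalizing x with
  | zero => rfl
  | succ n ih => rw [Function.iterate_succ_apply, sigmaHom_algebraMap, ih]; rfl

theorem sigmaHom_iterate_finrank {K : Type*} [Field K] [Algebra Fq K] [FiniteDimensional Fq K]
    (x : K) : (sigmaHom Fq K)^[Module.finrank Fq K] x = x := by
  have : Finite K := Module.finite_of_finite Fq
  have h : (FiniteField.frobeniusAlgEquivOfAlgebraic Fq K)⁻¹ ^ Module.finrank Fq K = 1 := by
    rw [← FiniteField.orderOf_frobeniusAlgEquivOfAlgebraic, ← orderOf_inv, pow_orderOf_eq_one]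
  have h2 := AlgEquiv.congr_fun h x
  rw [AlgEquiv.coe_pow] at h2
  exact h2

end Sigma

/-- Dual elements for the powers of `σ` on a finite extension `K` of `𝔽_q`, with values in a
larger field. -/
theorem exists_sigma_dual {Fq : Type*} [Field Fq] [Fintype Fq] {L : Type*} [Field L]
    {K : Type*} [Field K] [Algebra Fq K] [FiniteDimensional Fq K]
    (g : K →+* L) :
    ∃ (T : Finset K) (a : K → L), ∀ i < Module.finrank Fq K,
      ∑ b ∈ T, a b * g ((sigmaHom Fq K)^[i] b) = if i = 0 then 1 else 0 := by
  classical
  have : Finite K := Module.finite_of_finite Fq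
  let s := Module.finrank Fq K
  have hs : 0 < s := Module.finrank_pos
  let h : Fin s → K →* L := fun i => (g : K →* L).comp
    (((FiniteField.frobeniusAlgEquivOfAlgebraic Fq K)⁻¹ ^ i.1 : K ≃ₐ[Fq] K) : K →* K)
  have hh : ∀ i b, h i b = g ((sigmaHom Fq K)^[i.1] b) := fun i b => by
    change g (((FiniteField.frobeniusAlgEquivOfAlgebraic Fq K)⁻¹ ^ i.1 : K ≃ₐ[Fq] K) b) = _
    rw [AlgEquiv.coe_pow]
    rfl
  have hinj : Function.Injective h := by
    intro i j hij
    have h1 : (FiniteField.frobeniusAlgEquivOfAlgebraic Fq K)⁻¹ ^ i.1 =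
        (FiniteField.frobeniusAlgEquivOfAlgebraic Fq K)⁻¹ ^ j.1 :=
      AlgEquiv.ext fun x => g.injective (DFunLike.congr_fun hij x)
    rw [inv_pow, inv_pow, inv_inj] at h1
    exact (FiniteField.bijective_frobeniusAlgEquivOfAlgebraic_pow Fq K).1 h1
  have hli : LinearIndependent L (fun i : Fin s => (h i : K → L)) :=
    (linearIndependent_monoidHom K L).comp h hinj
  let v : K → Fin s → L := fun b i => h i b
  -- A nonzero functional vanishing on all `v b` would be a linear relation among the distinct
  -- characters `g ∘ σ^i`, against Dedekind's independence.
  have hspan : Submodule.span L (Set.range v) = ⊤ := by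
    by_contra hne
    obtain ⟨f, hf, hle⟩ := Submodule.exists_le_ker_of_lt_top _ (lt_top_iff_ne_top.mpr hne)
    apply hf
    have hz : ∀ i, f (Pi.single i 1) = 0 := by
      refine Fintype.linearIndependent_iff.mp hli (fun i => f (Pi.single i 1)) ?_
      funext b
      have hb : f (v b) = 0 := hle (Submodule.subset_span ⟨b, rfl⟩)
      rw [LinearMap.pi_apply_eq_sum_univ] at hb
      rw [Finset.sum_apply, Pi.zero_apply, ← hb]
      refine Finset.sum_congr rfl fun i _ => ?_
      rw [Pi.smul_apply, smul_eq_mul, smul_eq_mul, mul_comm]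
      congr 2
      funext j
      simp [Pi.single_apply, eq_comm]
    exact LinearMap.pi_ext' fun i => LinearMap.ext_ring (hz i)
  have hmem : (Pi.single ⟨0, hs⟩ 1 : Fin s → L) ∈ Submodule.span L (Set.range v) := by
    rw [hspan]; trivial
  obtain ⟨c, hc⟩ := (Finsupp.mem_span_range_iff_exists_finsupp).mp hmem
  refine ⟨c.support, c, fun i hi => ?_⟩
  have h2 := congrFun hc ⟨i, hi⟩
  rw [Finsupp.sum, Finset.sum_apply] at h2
  simp only [Pi.smul_apply, smul_eq_mul, v, hh] at h2
  rw [h2, Pi.single_apply]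
  simp [Fin.ext_iff]

theorem exists_extension_finrank (Fq : Type*) [Field Fq] [Fintype Fq] {s : ℕ} (hs : 0 < s) :
    ∃ (K : Type) (_ : Field K) (_ : Algebra Fq K) (_ : FiniteDimensional Fq K),
      Module.finrank Fq K = s := by
  have : NeZero s := ⟨hs.ne'⟩
  obtain ⟨p, hp⟩ := CharP.exists Fq
  have : Fact p.Prime := ⟨CharP.char_is_prime Fq p⟩
  let _ : Algebra (ZMod p) Fq := ZMod.algebra Fq p
  exact ⟨FiniteField.Extension Fq p s, inferInstance, inferInstance, inferInstance,
    FiniteField.finrank_extension Fq p s⟩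

variable [Algebra.IsAlgebraic Fq L] {V : Type*} [AddCommGroup V] [Module L V]
  {φ : V →+ V}


theorem semilinear_iterate_smul
    (hφ : ∀ (c : L) v, φ (c • v) = sigmaHom Fq L c • φ v)
    (n : ℕ) (c : L) (v : V) :
    φ^[n] (c • v) = (sigmaHom Fq L)^[n] c • φ^[n] v := by
  induction n generalizing c v with
  | zero => rfl
  | succ n ih => rw [Function.iterate_succ_apply, hφ, ih]; rfl

/-- Fixed vectors of a semilinear map which are linearly independent over the fixed field are
linearly independent. -/
theorem linearIndependent_of_fixed
    (hφ : ∀ (c : L) v, φ (c • v) = sigmaHom Fq L c • φ v)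
    [Module Fq V] [IsScalarTower Fq L V] {ι : Type*} {w : ι → V}
    (hw : ∀ i, φ (w i) = w i) (hli : LinearIndependent Fq w) : LinearIndependent L w := by
  classical
  rw [linearIndependent_iff']
  intro s
  induction s using Finset.induction_on with
  | empty => simp
  | insert i₀ s hi₀ ih =>
    intro c hc
    have key : c i₀ = 0 := by
      by_contra h0
      -- Artin's argument: with the coefficient at `i₀` normalised to `1`, applying `φ` and
      -- subtracting gives a shorter relation, so all `e i` are fixed by `σ` and lie in `𝔽_q`.
      let e : ι → L := fun i => (c i₀)⁻¹ * c i
      have he0 : e i₀ = 1 := inv_mul_cancel₀ h0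
      have he : w i₀ + ∑ i ∈ s, e i • w i = 0 := by
        have h1 := congrArg ((c i₀)⁻¹ • ·) hc
        simp only [smul_zero, Finset.smul_sum, ← mul_smul] at h1
        rw [Finset.sum_insert hi₀] at h1
        rw [← h1]
        congr 1
        rw [inv_mul_cancel₀ h0, one_smul]
      have he' : w i₀ + ∑ i ∈ s, sigmaHom Fq L (e i) • w i = 0 := by
        have h1 := congrArg φ he
        rw [map_zero, map_add, map_sum, hw] at h1
        rw [← h1]
        congr 1
        exact Finset.sum_congr rfl fun i _ => by rw [hφ, hw]
      have hd : ∑ i ∈ s, (sigmaHom Fq L (e i) - e i) • w i = 0 := by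
        simp only [sub_smul, Finset.sum_sub_distrib]
        rw [sub_eq_zero]
        exact add_left_cancel (he'.trans he.symm)
      have hfix : ∀ i ∈ s, ∃ a : Fq, algebraMap Fq L a = e i := fun i hi =>
        mem_range_algebraMap_of_sigmaHom_eq (sub_eq_zero.mp (ih _ hd i hi))
      choose! a ha using hfix
      have hrel : ∑ i ∈ insert i₀ s, (if i = i₀ then 1 else a i) • w i = 0 := by
        rw [Finset.sum_insert hi₀, if_pos rfl, one_smul, ← he]
        congr 1
        refine Finset.sum_congr rfl fun i hi => ?_
        rw [if_neg (fun h : i = i₀ => hi₀ (h ▸ hi)), ← ha i hi, algebraMap_smul]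
      have := linearIndependent_iff'.mp hli _ _ hrel i₀ (Finset.mem_insert_self _ _)
      rw [if_pos rfl] at this
      exact one_ne_zero this
    intro i hi
    rcases Finset.mem_insert.mp hi with rfl | hi
    · exact key
    · refine ih c ?_ i hi
      rwa [Finset.sum_insert hi₀, key, zero_smul, zero_add] at hc

/-- A semilinear map which permutes a finite spanning set is spanned by its fixed vectors. -/
theorem span_fixed_eq_top
    (hφ : ∀ (c : L) v, φ (c • v) = sigmaHom Fq L c • φ v)
    [IsAlgClosed L] {V₀ : Type*} [Finite V₀] (ι : V₀ → V) (φ₀ : V₀ → V₀)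
    (hφ₀ : Function.Injective φ₀) (hι : ∀ v, φ (ι v) = ι (φ₀ v))
    (hspan : Submodule.span L (Set.range ι) = ⊤) :
    Submodule.span L {v | φ v = v} = ⊤ := by
  rw [eq_top_iff, ← hspan, Submodule.span_le]
  rintro _ ⟨v, rfl⟩
  obtain ⟨s, hs, hper⟩ : ∃ s, 0 < s ∧ φ₀^[s] v = v := hφ₀.mem_periodicPts v
  have hperι : φ^[s] (ι v) = ι v := by
    have : ∀ n, φ^[n] (ι v) = ι (φ₀^[n] v) := fun n => by
      induction n with
      | zero => rfl
      | succ n ih => rw [Function.iterate_succ_apply', ih, hι, ← Function.iterate_succ_apply' φ₀]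
    rw [this, hper]
  obtain ⟨K, _, _, _, hK⟩ := exists_extension_finrank Fq hs
  let g : K →ₐ[Fq] L := IsAlgClosed.lift
  obtain ⟨T, a, ha⟩ := exists_sigma_dual (Fq := Fq) (g : K →+* L)
  have hσ := fun x : K => sigmaHom_iterate_finrank (Fq := Fq) x
  rw [hK] at ha hσ
  -- The degree of `K` is the period `s` of `v`, so `φ^s` fixes `b v` for `b` in `K`, and the orbit
  -- sum is fixed by `φ`.
  let w : K → V := fun b => ∑ i ∈ Finset.range s, φ^[i] (g b • ι v)
  have hw : ∀ b, φ (w b) = w b := fun b => by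
    have h1 : φ^[s] (g b • ι v) = g b • ι v := by
      rw [semilinear_iterate_smul hφ, hperι, sigmaHom_iterate_algebraMap,
        hσ]
    simp only [w, map_sum, ← Function.iterate_succ_apply' φ]
    have h2 := Finset.sum_range_succ' (fun i => φ^[i] (g b • ι v)) s
    rw [Finset.sum_range_succ, h1] at h2
    exact (add_right_cancel h2).symm
  -- The dual elements extract the term `i = 0` from the orbit sums.
  have hsum : ι v = ∑ b ∈ T, a b • w b := by
    simp only [w, Finset.smul_sum]
    rw [Finset.sum_comm, Finset.sum_eq_single_of_mem 0 (Finset.mem_range.mpr hs)]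
    · simp only [Function.iterate_zero, id, ← mul_smul, ← Finset.sum_smul]
      have h0 := ha 0 (hs)
      rw [if_pos rfl] at h0
      exact (one_smul L (ι v)).symm.trans (congrArg (· • ι v) h0.symm)
    · intro i hi hi0
      have h0 := ha i (Finset.mem_range.mp hi)
      rw [if_neg hi0] at h0
      simp only [semilinear_iterate_smul hφ, ← mul_smul, ← Finset.sum_smul,
        sigmaHom_iterate_algebraMap]
      exact (congrArg (· • φ^[i] (ι v)) h0).trans (zero_smul L _)
  rw [hsum]
  exact Submodule.sum_mem _ fun b _ => Submodule.smul_mem _ _ (Submodule.subset_span (hw b))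

/-- Applying `τ` turns the equation into the Artin–Schreier equation `x^q - x + c^q = 0`. -/
theorem exists_sigmaHom_sub_eq [IsAlgClosed L] (c : L) : ∃ x, sigmaHom Fq L x - x = c := by
  have h1 : 1 < Fintype.card Fq := Fintype.one_lt_card
  let p : L[X] := X ^ Fintype.card Fq - X + C (c ^ Fintype.card Fq)
  have hdeg : p.degree = Fintype.card Fq := by
    have h2 : (X ^ Fintype.card Fq - X : L[X]).degree = Fintype.card Fq := by
      rw [degree_eq_natDegree (FiniteField.X_pow_card_sub_X_ne_zero L h1),
        FiniteField.X_pow_card_sub_X_natDegree_eq L h1]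
    rw [degree_add_C (by rw [h2]; exact_mod_cast (zero_lt_one.trans h1)), h2]
  obtain ⟨x, hx⟩ := IsAlgClosed.exists_root p (by
    rw [hdeg]; exact_mod_cast (zero_lt_one.trans h1).ne')
  refine ⟨x, (sigmaHom_injective (Fq := Fq)).eq_iff.mp ?_ |>.symm⟩
  have h3 := congrArg (sigmaHom Fq L) (show x ^ Fintype.card Fq - x + c ^ Fintype.card Fq = 0 by
    simpa [p, IsRoot] using hx)
  rw [map_add, map_sub, sigmaHom_pow_card', sigmaHom_pow_card', map_zero] at h3
  rw [show c = sigmaHom Fq L x - x by linear_combination h3]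

/-- On a line spanned by a fixed vector, `φ - 1` is `c ↦ σ(c) - c`, which is onto. Multiples `c • v`
are carried along because the range of `φ - 1` is only additive. -/
theorem exists_sub_eq_of_span_fixed
    (hφ : ∀ (c : L) v, φ (c • v) = sigmaHom Fq L c • φ v)
    [IsAlgClosed L]
    (hspan : Submodule.span L {v | φ v = v} = ⊤) (v : V) : ∃ w, φ w - w = v := by
  have hall : ∀ v : V, ∀ c : L, c • v ∈ (φ - AddMonoidHom.id V).range := by
    intro v
    have hv : v ∈ Submodule.span L {v | φ v = v} := by rw [hspan]; trivial
    induction hv using Submodule.span_induction with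
    | mem v hv =>
      intro c
      obtain ⟨x, hx⟩ := exists_sigmaHom_sub_eq (Fq := Fq) c
      refine ⟨x • v, ?_⟩
      change φ (x • v) - x • v = _
      rw [hφ, show φ v = v from hv, ← sub_smul, hx]
    | zero => intro c; rw [smul_zero]; exact zero_mem _
    | add x y _ _ hx hy => intro c; rw [smul_add]; exact add_mem (hx c) (hy c)
    | smul a x _ hx => intro c; rw [← mul_smul]; exact hx _
  obtain ⟨w, hw⟩ := hall v 1
  exact ⟨w, hw.trans (one_smul L v)⟩

end Descent


/-! ### Twisted polynomials as polynomials -/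

namespace TwistedPoly

open Module

variable {k R : Type*} [CommRing k] [CommRing R] [Algebra k R] (φ : R →ₐ[k] R)

/-- The `R`-basis of powers of `φ` of the ring of twisted polynomials. -/
def powersBasis : Basis ℕ R (TwistedPoly φ) :=
  .ofRepr ((SkewMonoidAlgebra.coeffLinearEquiv (S := R)).trans
    ((Finsupp.domLCongr Multiplicative.toAdd).trans
      (Finsupp.mapRange.linearEquiv (LinearEquiv.refl R R : Twist φ ≃ₗ[R] R))))

theorem powersBasis_apply (n : ℕ) : powersBasis φ n = monomial φ n 1 := by
  apply (powersBasis φ).repr.injective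
  rw [Basis.repr_self]
  ext i
  change (Finsupp.single n 1 : ℕ →₀ R) i = _
  change _ = (Finsupp.single (Multiplicative.ofAdd n) (toTwist φ 1) : Multiplicative ℕ →₀ Twist φ)
    (Multiplicative.ofAdd i)
  by_cases h : n = i
  · subst h; rw [Finsupp.single_eq_same, Finsupp.single_eq_same]; rfl
  · rw [Finsupp.single_eq_of_ne (Ne.symm h), Finsupp.single_eq_of_ne]
    · rfl
    · exact fun h' => h (Multiplicative.ofAdd.injective h').symm

/-- The coefficientwise identification of twisted polynomials with ordinary polynomials. -/
def toPoly : TwistedPoly φ ≃ₗ[R] R[X] :=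
  (powersBasis φ).equiv (basisMonomials R) (Equiv.refl ℕ)

theorem toPoly_monomial (n : ℕ) (b : R) :
    toPoly φ (monomial φ n b) = Polynomial.monomial n b := by
  have h : monomial φ n b = b • powersBasis φ n := by
    rw [powersBasis_apply, smul_monomial, mul_one]
  rw [h, map_smul, toPoly, Basis.equiv_apply, coe_basisMonomials]
  exact (Polynomial.smul_monomial b n 1).trans (by rw [smul_eq_mul, mul_one])

theorem coeff_add (p r : TwistedPoly φ) (n : ℕ) : coeff (p + r) n = coeff p n + coeff r n :=
  congrArg (toTwist φ).symm (SkewPolynomial.coeff_add p r n)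

theorem coeff_monomial (m n : ℕ) (b : R) :
    coeff (monomial φ m b) n = if m = n then b else 0 := by
  change (toTwist φ).symm ((Finsupp.single (Multiplicative.ofAdd m) (toTwist φ b) :
    Multiplicative ℕ →₀ Twist φ) (Multiplicative.ofAdd n)) = _
  split_ifs with h
  · subst h; rw [Finsupp.single_eq_same]; rfl
  · rw [Finsupp.single_eq_of_ne]
    · rfl
    · exact fun h' => h (Multiplicative.ofAdd.injective h').symm

theorem toPoly_coeff (p : TwistedPoly φ) (n : ℕ) : (toPoly φ p).coeff n = coeff p n := by
  induction p using TwistedPoly.induction with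
  | zero => rw [map_zero, Polynomial.coeff_zero]; rfl
  | mono m b => rw [toPoly_monomial, Polynomial.coeff_monomial, coeff_monomial]
  | add p r hp hr => rw [map_add, Polynomial.coeff_add, hp, hr, coeff_add]

theorem toPoly_monomial_one_mul (p : TwistedPoly φ) :
    toPoly φ (monomial φ 1 1 * p) = X * (toPoly φ p).map (φ : R →+* R) := by
  induction p using TwistedPoly.induction with
  | zero => simp
  | mono m b =>
    rw [monomial_mul_monomial, toPoly_monomial, toPoly_monomial, Polynomial.map_monomial,
      X_mul_monomial, one_mul, pow_one, add_comm]
    rfl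
  | add p r hp hr => rw [mul_add, map_add, hp, hr, map_add, Polynomial.map_add, mul_add]

theorem coeff_mul_zero (p r : TwistedPoly φ) : coeff (p * r) 0 = coeff p 0 * coeff r 0 := by
  induction p using TwistedPoly.induction with
  | zero => rw [zero_mul]; change (0 : R) = 0 * _; rw [zero_mul]
  | add p p' hp hp' => rw [add_mul, coeff_add, coeff_add, hp, hp', add_mul]
  | mono m b =>
    induction r using TwistedPoly.induction with
    | zero => rw [mul_zero]; change (0 : R) = _ * 0; rw [mul_zero]
    | add r r' hr hr' => rw [mul_add, coeff_add, coeff_add, hr, hr', mul_add]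
    | mono n c =>
      rw [monomial_mul_monomial, coeff_monomial, coeff_monomial, coeff_monomial]
      rcases m with _ | m
      · rcases n with _ | n
        · simp
        · simp
      · simp

theorem monomial_add (n : ℕ) (a b : R) :
    monomial φ n (a + b) = monomial φ n a + monomial φ n b :=
  SkewMonoidAlgebra.single_add _ _ _

end TwistedPoly

/-! ### The adjoint, and evaluation of `∑ bᵢ σ^i` as `∑ τ^i(bᵢ)` -/

section Star

variable {Fq : Type*} [Field Fq] [Fintype Fq] {F : Type*} [Field F] [Algebra Fq F]
  [Algebra.IsAlgebraic Fq F]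

theorem oreStar_eq_sum (p : TwistedPoly (tauHom Fq F)) (s : Finset ℕ) (hs : p.support ⊆ s) :
    oreStar Fq p = ∑ n ∈ s,
      TwistedPoly.monomial (sigmaHom Fq F) n ((sigmaHom Fq F ^ n) (TwistedPoly.coeff p n)) := by
  refine Finset.sum_subset hs fun n _ hn => ?_
  have : TwistedPoly.coeff p n = 0 := by
    rw [SkewPolynomial.notMem_support_iff] at hn
    rw [TwistedPoly.coeff, hn, map_zero]
  rw [this, map_zero]
  exact SkewMonoidAlgebra.single_zero _

theorem oreStar_add (p r : TwistedPoly (tauHom Fq F)) :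
    oreStar Fq (p + r) = oreStar Fq p + oreStar Fq r := by
  classical
  rw [oreStar_eq_sum (p + r) (p.support ∪ r.support) SkewPolynomial.support_add,
    oreStar_eq_sum p (p.support ∪ r.support) Finset.subset_union_left,
    oreStar_eq_sum r (p.support ∪ r.support) Finset.subset_union_right, ← Finset.sum_add_distrib]
  exact Finset.sum_congr rfl fun n _ => by rw [TwistedPoly.coeff_add, map_add, TwistedPoly.monomial_add]

theorem oreStar_zero : oreStar Fq (0 : TwistedPoly (tauHom Fq F)) = 0 := rfl

theorem oreStar_monomial (n : ℕ) (b : F) :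
    oreStar Fq (TwistedPoly.monomial (tauHom Fq F) n b) =
      TwistedPoly.monomial (sigmaHom Fq F) n ((sigmaHom Fq F ^ n) b) := by
  have h := SkewPolynomial.support_monomial_subset n (a := toTwist (tauHom Fq F) b)
  rw [oreStar_eq_sum (TwistedPoly.monomial (tauHom Fq F) n b) {n} h, Finset.sum_singleton,
    TwistedPoly.coeff_monomial, if_pos rfl]

theorem coeff_oreStar_zero (p : TwistedPoly (tauHom Fq F)) :
    TwistedPoly.coeff (oreStar Fq p) 0 = TwistedPoly.coeff p 0 := by
  induction p using TwistedPoly.induction with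
  | zero => rfl
  | add p r hp hr => rw [oreStar_add, TwistedPoly.coeff_add, TwistedPoly.coeff_add, hp, hr]
  | mono n b =>
    rw [oreStar_monomial, TwistedPoly.coeff_monomial, TwistedPoly.coeff_monomial]
    split_ifs with h
    · subst h; rfl
    · rfl

variable (Fq) (L : Type*) [Field L] [Algebra Fq L]

/-- The additive map `∑ bᵢ Xⁱ ↦ ∑ τⁱ(bᵢ)`. -/
def evalTau : L[X] →ₗ[Fq] L := Polynomial.lsum fun n => ((tauHom Fq L) ^ n).toLinearMap

variable {L}

theorem tauHom_pow_apply (n : ℕ) (b : L) : (tauHom Fq L ^ n) b = b ^ Fintype.card Fq ^ n := by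
  rw [AlgHom.coe_pow, FiniteField.coe_frobeniusAlgHom, pow_iterate]

theorem evalTau_monomial (n : ℕ) (b : L) :
    evalTau Fq L (Polynomial.monomial n b) = b ^ Fintype.card Fq ^ n := by
  rw [evalTau, Polynomial.lsum_apply, Polynomial.sum_monomial_index]
  · exact tauHom_pow_apply Fq n b
  · exact map_zero _

variable {Fq}

theorem sigmaHom_pow_pow_card (n : ℕ) (x : F) :
    ((sigmaHom Fq F ^ n) x) ^ Fintype.card Fq ^ n = x := by
  induction n generalizing x with
  | zero => simp
  | succ n ih =>
    rw [pow_succ' (sigmaHom Fq F), pow_succ' (Fintype.card Fq), pow_mul, AlgHom.mul_apply,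
      sigmaHom_pow_card, ih]

variable [Algebra F L] [IsScalarTower Fq F L]

/-- On monomials, `(a σ^i)(b τ^j)* = a σ^(i+j)(b) σ^(i+j)`, and `τ^(i+j)` undoes the twist of `b`,
leaving `b τ^j(τ^i(ca))`. This is what makes the adjoint the right operator for points. -/
theorem evalTau_mul_oreStar (c : L) (n : TwistedPoly (sigmaHom Fq F))
    (p : TwistedPoly (tauHom Fq F)) :
    evalTau Fq L (c • (TwistedPoly.toPoly _ (n * oreStar Fq p)).map (algebraMap F L)) =
      twistedEval Fq F L p (evalTau Fq L (c • (TwistedPoly.toPoly _ n).map (algebraMap F L))) := by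
  induction p using TwistedPoly.induction with
  | zero => simp [oreStar_zero]
  | add p r hp hr =>
    rw [oreStar_add, mul_add, map_add, Polynomial.map_add, smul_add, map_add, hp, hr, map_add,
      LinearMap.add_apply]
  | mono j b =>
    induction n using TwistedPoly.induction with
    | zero => simp
    | add p r hp hr =>
      simp only [add_mul, map_add, Polynomial.map_add, smul_add, hp, hr]
    | mono i a =>
      rw [oreStar_monomial, TwistedPoly.monomial_mul_monomial, TwistedPoly.toPoly_monomial, TwistedPoly.toPoly_monomial,
        Polynomial.map_monomial, Polynomial.map_monomial, Polynomial.smul_monomial,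
        Polynomial.smul_monomial, evalTau_monomial, evalTau_monomial, twistedEval_monomial,
        ← AlgHom.mul_apply, ← pow_add, smul_eq_mul, smul_eq_mul, map_mul, ← mul_assoc, mul_pow,
        ← map_pow, sigmaHom_pow_pow_card, pow_add (Fintype.card Fq), pow_mul, mul_comm]

theorem evalTau_map (g : L →ₐ[F] L) (p : L[X]) :
    evalTau Fq L (p.map (g : L →+* L)) = g (evalTau Fq L p) := by
  induction p using Polynomial.induction_on' with
  | add p r hp hr => rw [Polynomial.map_add, map_add, hp, hr, map_add, map_add]
  | monomial n b =>
    rw [Polynomial.map_monomial, evalTau_monomial, evalTau_monomial, map_pow]; rfl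

end Star


/-! ### Base change of vectors of polynomials -/

section VecMap

open Module

variable {F L : Type*} [Field F] [Field L] {r s : ℕ}

/-- Apply a ring homomorphism to the coefficients of a vector of polynomials. -/
def vecMap (g : F →+* L) : (Fin r → F[X]) →+ (Fin r → L[X]) where
  toFun v := fun j => (v j).map g
  map_zero' := funext fun _ => Polynomial.map_zero g
  map_add' _ _ := funext fun _ => Polynomial.map_add g

theorem vecMap_apply (g : F →+* L) (v : Fin r → F[X]) (j : Fin r) :
    vecMap g v j = (v j).map g := rfl

theorem vecMap_smul (g : F →+* L) (p : F[X]) (v : Fin r → F[X]) :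
    vecMap g (p • v) = p.map g • vecMap g v :=
  funext fun _ => Polynomial.map_mul g

theorem vecMap_const_smul (g : F →+* L) (c : F) (v : Fin r → F[X]) :
    vecMap g (c • v) = g c • vecMap g v :=
  funext fun _ => Polynomial.map_smul g _

theorem vecMap_vecMap {K : Type*} [Field K] (g : F →+* L) (h : L →+* K) (v : Fin r → F[X]) :
    vecMap h (vecMap g v) = vecMap (h.comp g) v :=
  funext fun _ => Polynomial.map_map g h _

/-- The monomial `L`-basis of the vectors of polynomials. -/
def vecBasis (L : Type*) [Field L] (r : ℕ) : Basis (Σ _ : Fin r, ℕ) L (Fin r → L[X]) :=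
  Pi.basis fun _ => basisMonomials L

theorem vecBasis_apply (ji : Σ _ : Fin r, ℕ) :
    vecBasis L r ji = Pi.single ji.1 (monomial ji.2 1) := by
  rw [vecBasis, Pi.basis_apply, coe_basisMonomials]

theorem vecMap_vecBasis (g : F →+* L) (ji : Σ _ : Fin r, ℕ) :
    vecMap g (vecBasis F r ji) = vecBasis L r ji := by
  rw [vecBasis_apply, vecBasis_apply]
  funext j
  rw [vecMap_apply]
  by_cases h : j = ji.1
  · subst h; rw [Pi.single_eq_same, Pi.single_eq_same, Polynomial.map_monomial, map_one]
  · rw [Pi.single_eq_of_ne h, Pi.single_eq_of_ne h, Polynomial.map_zero]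

/-- `L[t]^r` is spanned over `L` by vectors with coefficients in `F`, so additive identities over
`L` reduce to the dual `t`-motive itself. -/
theorem vec_induction (g : F →+* L) {P : (Fin r → L[X]) → Prop} (w : Fin r → L[X])
    (zero : P 0) (add : ∀ v w, P v → P w → P (v + w))
    (smul : ∀ (c : L) (v : Fin r → F[X]), P (c • vecMap g v)) : P w := by
  have h : w ∈ Submodule.span L (Set.range (vecBasis L r)) := by
    rw [(vecBasis L r).span_eq]; trivial
  rw [← (vecBasis L r).linearCombination_repr w, Finsupp.linearCombination_apply]
  refine Finset.sum_induction _ P add zero fun ji _ => ?_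
  change P (_ • vecBasis L r ji)
  rw [← vecMap_vecBasis g]
  exact smul _ _

variable [Algebra F L]

/-- The `L`-linear extension of an `F`-linear map between vectors of polynomials. -/
def vecBaseChange (L : Type*) [Field L] [Algebra F L]
    (D : (Fin r → F[X]) →ₗ[F] (Fin s → F[X])) : (Fin r → L[X]) →ₗ[L] (Fin s → L[X]) :=
  (vecBasis L r).constr L fun ji => vecMap (algebraMap F L) (D (vecBasis F r ji))

/-- The map `D` need not be `F[t]`-linear: in the application the variable is `t` on one side and
stands for `σ` on the other. Hence extension along an `F`-basis rather than by a matrix of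
polynomials. -/
theorem vecBaseChange_vecMap (D : (Fin r → F[X]) →ₗ[F] (Fin s → F[X])) (v : Fin r → F[X]) :
    vecBaseChange L D (vecMap (algebraMap F L) v) = vecMap (algebraMap F L) (D v) := by
  conv_lhs => rw [← (vecBasis F r).linearCombination_repr v]
  conv_rhs => rw [← (vecBasis F r).linearCombination_repr v]
  simp only [Finsupp.linearCombination_apply, Finsupp.sum, map_sum, map_smul, vecMap_const_smul]
  refine Finset.sum_congr rfl fun ji _ => ?_
  rw [vecMap_vecBasis, vecBaseChange, Basis.constr_basis]

theorem vecBaseChange_smul_vecMap (D : (Fin r → F[X]) →ₗ[F] (Fin s → F[X])) (c : L)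
    (v : Fin r → F[X]) : vecBaseChange L D (c • vecMap (algebraMap F L) v) =
      c • vecMap (algebraMap F L) (D v) := by
  rw [map_smul, vecBaseChange_vecMap]

theorem vecBaseChange_symm_apply (D : (Fin r → F[X]) ≃ₗ[F] (Fin s → F[X]))
    (w : Fin r → L[X]) :
    vecBaseChange L D.symm.toLinearMap (vecBaseChange L D.toLinearMap w) = w := by
  induction w using vec_induction (algebraMap F L) with
  | zero => simp
  | add v w hv hw => rw [map_add, map_add, hv, hw]
  | smul c v =>
    rw [vecBaseChange_smul_vecMap, vecBaseChange_smul_vecMap]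
    simp

theorem vecBaseChange_apply_symm (D : (Fin r → F[X]) ≃ₗ[F] (Fin s → F[X]))
    (w : Fin s → L[X]) :
    vecBaseChange L D.toLinearMap (vecBaseChange L D.symm.toLinearMap w) = w :=
  vecBaseChange_symm_apply D.symm w

/-- The action of `σ` on vectors over `L[t]` for the matrix `Φ` over `F[t]`:
`v ↦ Φ v^(σ)`. -/
def sigmaVec {Fq : Type*} [Field Fq] [Fintype Fq] (Φ : Matrix (Fin r) (Fin r) F[X])
    (L : Type*) [Field L] [Algebra Fq L] [Algebra.IsAlgebraic Fq L] [Algebra F L] :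
    (Fin r → L[X]) →+ (Fin r → L[X]) where
  toFun w := Matrix.mulVec (Φ.map (Polynomial.map (algebraMap F L)))
    (vecMap (sigmaHom Fq L : L →+* L) w)
  map_zero' := by rw [map_zero, Matrix.mulVec_zero]
  map_add' v w := by rw [map_add, Matrix.mulVec_add]

variable {Fq : Type*} [Field Fq] [Fintype Fq] [Algebra Fq F] [Algebra.IsAlgebraic Fq F]
  [Algebra Fq L] [Algebra.IsAlgebraic Fq L] [IsScalarTower Fq F L]
  (Φ : Matrix (Fin r) (Fin r) F[X])

theorem sigmaVec_apply (w : Fin r → L[X]) :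
    sigmaVec (Fq := Fq) Φ L w = Matrix.mulVec (Φ.map (Polynomial.map (algebraMap F L)))
      (vecMap (sigmaHom Fq L : L →+* L) w) := rfl

theorem sigmaVec_smul (p : L[X]) (w : Fin r → L[X]) :
    sigmaVec (Fq := Fq) Φ L (p • w) =
      p.map (sigmaHom Fq L : L →+* L) • sigmaVec (Fq := Fq) Φ L w := by
  rw [sigmaVec_apply, sigmaVec_apply, vecMap_smul, Matrix.mulVec_smul]

theorem sigmaVec_const_smul (c : L) (w : Fin r → L[X]) :
    sigmaVec (Fq := Fq) Φ L (c • w) = sigmaHom Fq L c • sigmaVec (Fq := Fq) Φ L w := by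
  rw [sigmaVec_apply, sigmaVec_apply, vecMap_const_smul, Matrix.mulVec_smul]; rfl

theorem sigmaVec_base_smul (p : Fq[X]) (w : Fin r → L[X]) :
    sigmaVec (Fq := Fq) Φ L (p.map (algebraMap Fq L) • w) =
      p.map (algebraMap Fq L) • sigmaVec (Fq := Fq) Φ L w := by
  rw [sigmaVec_smul, Polynomial.map_map]
  congr 2
  exact (sigmaHom Fq L).comp_algebraMap

theorem sigmaVec_vecMap (v : Fin r → F[X]) :
    sigmaVec (Fq := Fq) Φ L (vecMap (algebraMap F L) v) =
      vecMap (algebraMap F L) (sigmaVec (Fq := Fq) Φ F v) := by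
  funext i
  simp only [sigmaVec_apply, vecMap_apply, Matrix.mulVec, dotProduct, Matrix.map_apply,
    Polynomial.map_sum, Polynomial.map_mul, Polynomial.map_map]
  refine Finset.sum_congr rfl fun j _ => ?_
  congr 2
  ext x
  exact sigmaHom_algebraMap (IsScalarTower.toAlgHom Fq F L) x

theorem sigmaVec_map_comm (g : L →ₐ[F] L) (w : Fin r → L[X]) :
    sigmaVec (Fq := Fq) Φ L (vecMap (g : L →+* L) w) =
      vecMap (g : L →+* L) (sigmaVec (Fq := Fq) Φ L w) := by
  funext i
  simp only [sigmaVec_apply, vecMap_apply, Matrix.mulVec, dotProduct, Matrix.map_apply,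
    Polynomial.map_sum, Polynomial.map_mul, Polynomial.map_map]
  refine Finset.sum_congr rfl fun j _ => ?_
  congr 2
  · exact (g.comp_algebraMap).symm
  · ext x
    exact sigmaHom_algebraMap (g.restrictScalars Fq) x

end VecMap

/-! ### Coordinates on the dual `t`-motive -/

namespace TModule

open Module

variable {Fq : Type*} [Field Fq] [Fintype Fq] {F : Type*} [Field F] [Algebra Fq F]
  [Algebra.IsAlgebraic Fq F] {θ : F} {ℓ : ℕ} (E : TModule Fq F θ ℓ)

/-- The left coefficients of an element of the dual `t`-motive. -/
def dualCoeffs : E.DualMotive ≃ₗ[F] (Fin ℓ → F[X]) :=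
  (AEval.of F _ (rowMul (E.adjoint X))).symm.trans
    (LinearEquiv.piCongrRight fun _ => TwistedPoly.toPoly (sigmaHom Fq F))

theorem dualCoeffs_of (m : Fin ℓ → TwistedPoly (sigmaHom Fq F)) (k : Fin ℓ) :
    E.dualCoeffs (AEval'.of _ m) k = TwistedPoly.toPoly _ (m k) := rfl

/-- Left multiplication by `σ` on the dual `t`-motive. -/
def dualSigma : E.DualMotive →+ E.DualMotive where
  toFun n := AEval'.of _ fun k => TwistedPoly.monomial (sigmaHom Fq F) 1 1 *
    (AEval'.of (rowMul (E.adjoint X))).symm n k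
  map_zero' := by
    rw [map_zero]
    simp only [Pi.zero_apply, mul_zero]
    exact map_zero _
  map_add' n n' := by
    rw [map_add]
    simp only [Pi.add_apply, mul_add]
    exact map_add (AEval'.of _) _ _

theorem dualSigma_of (m : Fin ℓ → TwistedPoly (sigmaHom Fq F)) :
    E.dualSigma (AEval'.of _ m) =
      AEval'.of _ fun k => TwistedPoly.monomial (sigmaHom Fq F) 1 1 * m k := rfl

theorem dualCoeffs_dualSigma (n : E.DualMotive) (k : Fin ℓ) :
    E.dualCoeffs (E.dualSigma n) k =
      X * (E.dualCoeffs n k).map (sigmaHom Fq F : F →+* F) :=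
  TwistedPoly.toPoly_monomial_one_mul _ _

/-- `t` acts by right multiplication and so commutes with `σ` on the left; only the coefficients are
twisted. -/
theorem dualSigma_smul (p : F[X]) (n : E.DualMotive) :
    E.dualSigma (p • n) = p.map (sigmaHom Fq F : F →+* F) • E.dualSigma n := by
  induction p using Polynomial.induction_on' generalizing n with
  | add p p' hp hp' => rw [add_smul, map_add, hp, hp', Polynomial.map_add, add_smul]
  | monomial i b =>
    have hC : ∀ (c : F) (n : E.DualMotive),
        E.dualSigma (C c • n) = C (sigmaHom Fq F c) • E.dualSigma n := fun c n => by
      obtain ⟨m, rfl⟩ := (AEval'.of (rowMul (E.adjoint X))).surjective n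
      rw [AEval.C_smul, AEval.C_smul, dualSigma_of, ← map_smul, ← map_smul, dualSigma_of]
      congr 1
      funext k
      simp only [Pi.smul_apply]
      rw [TwistedPoly.smul_eq_monomial_mul, ← mul_assoc, TwistedPoly.monomial_mul_monomial,
        TwistedPoly.smul_eq_monomial_mul, ← mul_assoc, TwistedPoly.monomial_mul_monomial]
      simp
    have hX : ∀ n : E.DualMotive, E.dualSigma ((X : F[X]) • n) = (X : F[X]) • E.dualSigma n :=
      fun n => by
      obtain ⟨m, rfl⟩ := (AEval'.of (rowMul (E.adjoint X))).surjective n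
      rw [AEval'.X_smul_of, dualSigma_of, dualSigma_of, AEval'.X_smul_of]
      congr 1
      funext k
      change TwistedPoly.monomial (sigmaHom Fq F) 1 1 * ∑ j : Fin ℓ, m j * E.adjoint X j k =
        ∑ j : Fin ℓ, (TwistedPoly.monomial (sigmaHom Fq F) 1 1 * m j) * E.adjoint X j k
      rw [Finset.mul_sum]
      simp only [mul_assoc]
    have hXi : ∀ n : E.DualMotive,
        E.dualSigma ((X ^ i : F[X]) • n) = (X ^ i : F[X]) • E.dualSigma n := fun n => by
      induction i with
      | zero => simp
      | succ i ih => rw [pow_succ', mul_smul, hX, ih, mul_smul]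
    rw [← C_mul_X_pow_eq_monomial, mul_smul, hC, hXi, Polynomial.map_mul, Polynomial.map_C,
      Polynomial.map_pow, Polynomial.map_X, mul_smul]
    rfl

/-- The star preserves constant terms and the adjoint transposes, so on the column of constant terms
`t` acts through `∂E_t`. This is how the nilpotency condition enters. -/
theorem coeff_zero_X_smul (n : E.DualMotive) (k : Fin ℓ) :
    (E.dualCoeffs ((X : F[X]) • n) k).coeff 0 =
      ∑ j, TwistedPoly.coeff (E.hom X k j) 0 * (E.dualCoeffs n j).coeff 0 := by
  obtain ⟨m, rfl⟩ := (AEval'.of (rowMul (E.adjoint X))).surjective n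
  rw [AEval'.X_smul_of, dualCoeffs_of]
  change (TwistedPoly.toPoly _ (∑ j, m j * oreStar Fq (E.hom X k j))).coeff 0 = _
  rw [map_sum, finsetSum_coeff]
  refine Finset.sum_congr rfl fun j _ => ?_
  rw [dualCoeffs_of, TwistedPoly.toPoly_coeff, TwistedPoly.toPoly_coeff,
    TwistedPoly.coeff_mul_zero, coeff_oreStar_zero, mul_comm]

variable {r : ℕ} (e : Basis (Fin r) F[X] E.DualMotive)

/-- The matrix of `σ` in a basis of the dual `t`-motive. -/
def sigmaMatrix : Matrix (Fin r) (Fin r) F[X] := fun i j => e.repr (E.dualSigma (e j)) i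

theorem sigmaVec_equivFun (n : E.DualMotive) :
    sigmaVec (Fq := Fq) (E.sigmaMatrix e) F (e.equivFun n) = e.equivFun (E.dualSigma n) := by
  have h : E.dualSigma n = ∑ j, (e.equivFun n j).map (sigmaHom Fq F : F →+* F) •
      E.dualSigma (e j) := by
    conv_lhs => rw [← e.sum_equivFun n]
    rw [map_sum]
    exact Finset.sum_congr rfl fun j _ => E.dualSigma_smul _ _
  rw [h, map_sum]
  funext i
  rw [sigmaVec_apply, Finset.sum_apply]
  simp only [Matrix.mulVec, dotProduct, Matrix.map_apply, map_smul, Pi.smul_apply, smul_eq_mul]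
  refine Finset.sum_congr rfl fun j _ => ?_
  rw [mul_comm]
  congr 1
  exact Polynomial.map_id

/-- The passage from coordinates over `F[t]` to left coefficients. -/
def coordEquiv : (Fin r → F[X]) ≃ₗ[F] (Fin ℓ → F[X]) :=
  (e.equivFun.restrictScalars F).symm.trans E.dualCoeffs

theorem coordEquiv_equivFun (n : E.DualMotive) :
    E.coordEquiv e (e.equivFun n) = E.dualCoeffs n := by
  change E.dualCoeffs (e.equivFun.symm (e.equivFun n)) = _
  rw [LinearEquiv.symm_apply_apply]

theorem exists_equivFun_eq (v : Fin r → F[X]) : ∃ n : E.DualMotive, e.equivFun n = v :=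
  e.equivFun.surjective v

variable (L : Type*) [Field L] [Algebra Fq L] [Algebra F L] [IsScalarTower Fq F L]

/-- The map from `L[t]^r = L ⊗ (dual t-motive)` onto `E(L)`. -/
def toPoints : (Fin r → L[X]) →+ E.Points L where
  toFun w := fun k => evalTau Fq L (vecBaseChange L (E.coordEquiv e).toLinearMap w k)
  map_zero' := by
    funext k
    rw [map_zero, Pi.zero_apply, map_zero]
    rfl
  map_add' v w := by
    funext k
    rw [map_add, Pi.add_apply, map_add]
    rfl

variable {L}

theorem toPoints_apply (w : Fin r → L[X]) (k : Fin ℓ) :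
    E.toPoints e L w k = evalTau Fq L (vecBaseChange L (E.coordEquiv e).toLinearMap w k) := rfl

theorem toPoints_smul_vecMap (c : L) (n : E.DualMotive) (k : Fin ℓ) :
    E.toPoints e L (c • vecMap (algebraMap F L) (e.equivFun n)) k =
      evalTau Fq L (c • (E.dualCoeffs n k).map (algebraMap F L)) := by
  rw [toPoints_apply, vecBaseChange_smul_vecMap, LinearEquiv.coe_coe, coordEquiv_equivFun]
  rfl

theorem toPoints_X_smul (w : Fin r → L[X]) :
    E.toPoints e L ((X : L[X]) • w) = (X : Fq[X]) • E.toPoints e L w := by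
  induction w using vec_induction (algebraMap F L) with
  | zero => rw [smul_zero, map_zero, smul_zero]
  | add v w hv hw => rw [smul_add, map_add, hv, hw, map_add, smul_add]
  | smul c v =>
    obtain ⟨n, rfl⟩ := E.exists_equivFun_eq e v
    have h : (X : L[X]) • c • vecMap (algebraMap F L) (e.equivFun n) =
        c • vecMap (algebraMap F L) (e.equivFun ((X : F[X]) • n)) := by
      rw [map_smul, vecMap_smul, Polynomial.map_X, smul_comm]
    rw [h]
    funext k
    rw [toPoints_smul_vecMap]
    refine Eq.trans ?_ (E.action_apply L X _ k).symm
    simp only [toPoints_smul_vecMap]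
    obtain ⟨m, rfl⟩ := (AEval'.of (rowMul (E.adjoint X))).surjective n
    rw [AEval'.X_smul_of, dualCoeffs_of]
    change evalTau Fq L (c • (TwistedPoly.toPoly _
      (∑ j, m j * oreStar Fq (E.hom X k j))).map (algebraMap F L)) = _
    rw [map_sum, Polynomial.map_sum, Finset.smul_sum, map_sum]
    exact Finset.sum_congr rfl fun j _ => evalTau_mul_oreStar c _ _

theorem toPoints_base_smul (a : Fq[X]) (w : Fin r → L[X]) :
    E.toPoints e L (a.map (algebraMap Fq L) • w) = a • E.toPoints e L w := by
  induction a using Polynomial.induction_on' generalizing w with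
  | add a b ha hb => rw [Polynomial.map_add, add_smul, map_add, ha, hb, add_smul]
  | monomial i c =>
    have hX : ∀ w : Fin r → L[X],
        E.toPoints e L ((X ^ i : L[X]) • w) = (X ^ i : Fq[X]) • E.toPoints e L w := fun w => by
      induction i with
      | zero => simp
      | succ i ih => rw [pow_succ', mul_smul, toPoints_X_smul, ih, pow_succ', mul_smul]
    rw [← C_mul_X_pow_eq_monomial, Polynomial.map_mul, Polynomial.map_pow, Polynomial.map_X,
      Polynomial.map_C, mul_smul, mul_smul, ← hX]
    funext k
    rw [smul_points, show C c = algebraMap Fq Fq[X] c from rfl, AlgHom.commutes]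
    change _ = c • (E.toPoints e L ((X ^ i : L[X]) • w) k)
    rw [toPoints_apply, toPoints_apply, ← map_smul]
    congr 1
    have h : C (algebraMap Fq L c) • (X ^ i : L[X]) • w =
        algebraMap Fq L c • ((X ^ i : L[X]) • w) := by
      funext j
      exact (Polynomial.smul_eq_C_mul _).symm
    rw [h, map_smul, Pi.smul_apply, algebraMap_smul]

theorem toPoints_map (g : L →ₐ[F] L) (w : Fin r → L[X]) :
    E.toPoints e L (vecMap (g : L →+* L) w) = E.pointsMap g (E.toPoints e L w) := by
  induction w using vec_induction (algebraMap F L) with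
  | zero => simp
  | add v w hv hw => rw [map_add, map_add, hv, hw, map_add, map_add]
  | smul c v =>
    obtain ⟨n, rfl⟩ := E.exists_equivFun_eq e v
    funext k
    change _ = g (E.toPoints e L (c • vecMap (algebraMap F L) (e.equivFun n)) k)
    rw [vecMap_const_smul, vecMap_vecMap, RingHom.coe_coe, AlgHom.comp_algebraMap,
      toPoints_smul_vecMap, toPoints_smul_vecMap, ← evalTau_map, Polynomial.map_smul,
      Polynomial.map_map, AlgHom.comp_algebraMap]
    rfl

theorem toPoints_surjective : Function.Surjective (E.toPoints e L) := by
  intro x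
  refine ⟨vecBaseChange L (E.coordEquiv e).symm.toLinearMap fun k => C (x k), ?_⟩
  funext k
  rw [toPoints_apply, vecBaseChange_apply_symm, ← monomial_zero_left, evalTau_monomial, pow_zero,
    pow_one]

section Sigma

variable [Algebra.IsAlgebraic Fq L]

/-- In left coefficients the variable is `σ`, so `σ` acts as a shift combined with a twist. -/
theorem vecBaseChange_sigmaVec (w : Fin r → L[X]) (k : Fin ℓ) :
    vecBaseChange L (E.coordEquiv e).toLinearMap
        (sigmaVec (Fq := Fq) (E.sigmaMatrix e) L w) k =
      X * (vecBaseChange L (E.coordEquiv e).toLinearMap w k).map (sigmaHom Fq L : L →+* L) := by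
  induction w using vec_induction (algebraMap F L) with
  | zero => simp
  | add v w hv hw =>
    rw [map_add, map_add, Pi.add_apply, hv, hw, map_add, Pi.add_apply, Polynomial.map_add, mul_add]
  | smul c v =>
    obtain ⟨n, rfl⟩ := E.exists_equivFun_eq e v
    rw [sigmaVec_const_smul, sigmaVec_vecMap, sigmaVec_equivFun, vecBaseChange_smul_vecMap,
      vecBaseChange_smul_vecMap, LinearEquiv.coe_coe, coordEquiv_equivFun, coordEquiv_equivFun,
      Pi.smul_apply, Pi.smul_apply, vecMap_apply, vecMap_apply, dualCoeffs_dualSigma,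
      Polynomial.map_mul, Polynomial.map_X, Polynomial.map_smul, mul_smul_comm,
      Polynomial.map_map, Polynomial.map_map]
    have hcomp : (sigmaHom Fq L : L →+* L).comp (algebraMap F L) =
        (algebraMap F L).comp (sigmaHom Fq F : F →+* F) := by
      ext x
      exact sigmaHom_algebraMap (IsScalarTower.toAlgHom Fq F L) x
    rw [hcomp]
    rfl

/-- The shift makes the constant coefficient of a fixed vector vanish, then every later one in turn.
-/
theorem sigmaVec_fixed_eq_zero {w : Fin r → L[X]}
    (hw : sigmaVec (Fq := Fq) (E.sigmaMatrix e) L w = w) : w = 0 := by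
  have h : vecBaseChange L (E.coordEquiv e).toLinearMap w = 0 := by
    funext k
    have hk := E.vecBaseChange_sigmaVec e w k
    rw [hw] at hk
    ext i
    rw [Pi.zero_apply, coeff_zero]
    induction i with
    | zero => rw [hk, mul_coeff_zero, coeff_X_zero, zero_mul]
    | succ i ih => rw [hk, coeff_X_mul, coeff_map, ih, map_zero]
  rw [← vecBaseChange_symm_apply (E.coordEquiv e) w, h, map_zero]

theorem toPoints_sigmaVec (w : Fin r → L[X]) :
    E.toPoints e L (sigmaVec (Fq := Fq) (E.sigmaMatrix e) L w) = E.toPoints e L w := by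
  funext k
  rw [toPoints_apply, toPoints_apply, vecBaseChange_sigmaVec]
  generalize vecBaseChange L (E.coordEquiv e).toLinearMap w k = p
  induction p using Polynomial.induction_on' with
  | add p p' hp hp' => rw [Polynomial.map_add, mul_add, map_add, hp, hp', map_add]
  | monomial i b =>
    rw [Polynomial.map_monomial, X_mul_monomial, evalTau_monomial, evalTau_monomial, pow_succ',
      pow_mul]
    congr 1
    exact sigmaHom_pow_card b

/-- Modulo `σ - 1`, every left polynomial is congruent to the constant given by its evaluation. -/
theorem toPoints_eq_zero_iff {w : Fin r → L[X]} :
    E.toPoints e L w = 0 ↔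
      ∃ z, sigmaVec (Fq := Fq) (E.sigmaMatrix e) L z - z = w := by
  constructor
  · intro h0
    have key : ∀ p : L[X], ∃ z, X * z.map (sigmaHom Fq L : L →+* L) - z =
        p - C (evalTau Fq L p) := by
      intro p
      induction p using Polynomial.induction_on' with
      | add p p' hp hp' =>
        obtain ⟨z, hz⟩ := hp
        obtain ⟨z', hz'⟩ := hp'
        refine ⟨z + z', ?_⟩
        rw [Polynomial.map_add, map_add, C_add]
        linear_combination hz + hz'
      | monomial i b =>
        rw [evalTau_monomial]
        induction i generalizing b with
        | zero => exact ⟨0, by simp⟩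
        | succ i ih =>
          obtain ⟨z, hz⟩ := ih (b ^ Fintype.card Fq)
          -- `b σ^(i+1) - b^q σ^i = (σ - 1)(b^q σ^i)`, so the degree drops by one while the
          -- evaluation is unchanged.
          refine ⟨z + monomial i (b ^ Fintype.card Fq), ?_⟩
          rw [Polynomial.map_add, Polynomial.map_monomial, mul_add, X_mul_monomial,
            RingHom.coe_coe, sigmaHom_pow_card', pow_succ', pow_mul]
          linear_combination hz
    choose z hz using fun k => key (vecBaseChange L (E.coordEquiv e).toLinearMap w k)
    refine ⟨vecBaseChange L (E.coordEquiv e).symm.toLinearMap z, ?_⟩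
    rw [← vecBaseChange_symm_apply (E.coordEquiv e) (_ - _),
      ← vecBaseChange_symm_apply (E.coordEquiv e) w]
    congr 1
    funext k
    rw [map_sub, Pi.sub_apply, vecBaseChange_sigmaVec, vecBaseChange_apply_symm, hz]
    have : evalTau Fq L (vecBaseChange L (E.coordEquiv e).toLinearMap w k) = 0 := congrFun h0 k
    rw [this, C_0, sub_zero]
  · rintro ⟨z, rfl⟩
    rw [map_sub, toPoints_sigmaVec, sub_self]

end Sigma

/-- Outside the characteristic, `σ` is surjective on the dual `t`-motive modulo `λ`. -/
theorem exists_eq_sigmaVec_add {lam : Fq[X]} (hlam : aeval θ lam ≠ 0) (v : Fin r → F[X]) :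
    ∃ v' v'', v = sigmaVec (Fq := Fq) (E.sigmaMatrix e) F v' +
      lam.map (algebraMap Fq F) • v'' := by
  obtain ⟨n, rfl⟩ := E.exists_equivFun_eq e v
  obtain ⟨K, hK⟩ := E.nilpotent
  let T : Matrix (Fin ℓ) (Fin ℓ) F :=
    (E.hom X).map (fun b => TwistedPoly.coeff b 0) - Matrix.diagonal (fun _ => θ)
  let c0 : E.DualMotive → Fin ℓ → F := fun n k => (E.dualCoeffs n k).coeff 0
  have hT : ∀ n, c0 ((X - C θ : F[X]) • n) = Matrix.mulVec T (c0 n) := by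
    intro n
    funext k
    simp only [c0, sub_smul, map_sub, Pi.sub_apply, coeff_sub]
    rw [coeff_zero_X_smul, AEval.C_smul, map_smul, Pi.smul_apply, coeff_smul, smul_eq_mul]
    simp only [T, Matrix.sub_mulVec, Pi.sub_apply, Matrix.mulVec_diagonal]
    rfl
  have hTK : ∀ i n, c0 ((X - C θ : F[X]) ^ i • n) = Matrix.mulVec (T ^ i) (c0 n) := by
    intro i
    induction i with
    | zero => intro n; simp
    | succ i ih => intro n; rw [pow_succ', mul_smul, hT, ih, Matrix.mulVec_mulVec, ← pow_succ']
  -- Since `(t-θ)^K` kills constant terms, writing `1` as a combination of it and `λ` moves `n`,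
  -- modulo `λ`, to an element with zero constant term.
  have hcop : IsCoprime ((X - C θ : F[X]) ^ K) (lam.map (algebraMap Fq F)) := by
    refine IsCoprime.pow_left ((irreducible_X_sub_C θ).coprime_iff_not_dvd.mpr ?_)
    rw [dvd_iff_isRoot, IsRoot, eval_map_algebraMap]
    exact hlam
  obtain ⟨a, b, hab⟩ := hcop
  have hz : c0 (n - (b * lam.map (algebraMap Fq F)) • n) = 0 := by
    have h1 : n - (b * lam.map (algebraMap Fq F)) • n =
        (X - C θ : F[X]) ^ K • (a • n) := by
      rw [← mul_smul, mul_comm _ a]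
      nth_rw 1 [← one_smul F[X] n]
      rw [← hab, add_smul, add_sub_cancel_right]
    rw [h1, hTK, show T ^ K = 0 from hK, Matrix.zero_mulVec]
  -- Zero constant term means left divisible by `σ`: shift down and untwist by Frobenius.
  have hdiv : ∀ n : E.DualMotive, c0 n = 0 → ∃ n', n = E.dualSigma n' := by
    intro n hn
    refine ⟨E.dualCoeffs.symm fun k => ((E.dualCoeffs n k).divX).map
      (FiniteField.frobeniusAlgHom Fq F : F →+* F), ?_⟩
    apply E.dualCoeffs.injective
    funext k
    rw [dualCoeffs_dualSigma, LinearEquiv.apply_symm_apply, Polynomial.map_map]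
    have hid : (sigmaHom Fq F : F →+* F).comp (FiniteField.frobeniusAlgHom Fq F : F →+* F) =
        RingHom.id F := by
      ext x
      exact sigmaHom_pow_card' x
    rw [hid, Polynomial.map_id]
    have h2 := (E.dualCoeffs n k).X_mul_divX_add
    rw [show (E.dualCoeffs n k).coeff 0 = 0 from congrFun hn k, C_0, add_zero] at h2
    exact h2.symm
  obtain ⟨n', hn'⟩ := hdiv _ hz
  refine ⟨e.equivFun n', e.equivFun (b • n), ?_⟩
  rw [sigmaVec_equivFun, ← hn', ← map_smul, ← map_add, ← mul_smul, mul_comm b, sub_add_cancel]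

end TModule


/-! ### Powers of `σ` and the order of the rational points -/

section SigmaPow

variable {Fq : Type*} [Field Fq] [Fintype Fq] {F : Type*} [Field F] [Algebra Fq F]
  [Algebra.IsAlgebraic Fq F] {r : ℕ}

/-- The matrix `Φ Φ^(σ) ⋯ Φ^(σ^(n-1))` of the `n`-th power of `σ`. -/
def sigmaMatrixPow (Fq : Type*) [Field Fq] [Fintype Fq] {F : Type*} [Field F] [Algebra Fq F]
    [Algebra.IsAlgebraic Fq F] {r : ℕ} (Φ : Matrix (Fin r) (Fin r) F[X]) :
    ℕ → Matrix (Fin r) (Fin r) F[X]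
  | 0 => 1
  | n + 1 => Φ * (sigmaMatrixPow Fq Φ n).map (Polynomial.map (sigmaHom Fq F : F →+* F))

variable (Φ : Matrix (Fin r) (Fin r) F[X])
  {L : Type*} [Field L] [Algebra Fq L] [Algebra.IsAlgebraic Fq L] [Algebra F L]
  [IsScalarTower Fq F L]

theorem vecMap_mulVec {K K' : Type*} [Field K] [Field K'] (g : K →+* K')
    (S : Matrix (Fin r) (Fin r) K[X]) (w : Fin r → K[X]) :
    vecMap g (S.mulVec w) = (S.map (Polynomial.map g)).mulVec (vecMap g w) := by
  funext i
  simp only [vecMap_apply, Matrix.mulVec, dotProduct, Matrix.map_apply, Polynomial.map_sum,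
    Polynomial.map_mul]

/-- Each application of `σ` twists the previous matrix and multiplies by `Φ`. When `σ^n` is trivial
on `F`, this makes the action on `F[t]^r` linear. -/
theorem sigmaVec_iterate (n : ℕ) (w : Fin r → L[X]) :
    (sigmaVec (Fq := Fq) Φ L)^[n] w =
      ((sigmaMatrixPow Fq Φ n).map (Polynomial.map (algebraMap F L))).mulVec
        (vecMap ((sigmaHom Fq L ^ n : L →ₐ[Fq] L) : L →+* L) w) := by
  induction n with
  | zero =>
    rw [sigmaMatrixPow, Matrix.map_one _ (Polynomial.map_zero _) (Polynomial.map_one _),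
      Matrix.one_mulVec]
    exact (funext fun j => Polynomial.map_id).symm
  | succ n ih =>
    rw [Function.iterate_succ_apply', ih, sigmaVec_apply, vecMap_mulVec, vecMap_vecMap,
      Matrix.mulVec_mulVec, sigmaMatrixPow]
    congr 1
    · ext1 i j
      simp only [Matrix.map_apply, Matrix.mul_apply, Polynomial.map_sum, Polynomial.map_mul,
        Polynomial.map_map]
      refine Finset.sum_congr rfl fun k _ => ?_
      congr 2
      ext x
      exact sigmaHom_algebraMap (IsScalarTower.toAlgHom Fq F L) x
    · congr 1
      rw [pow_succ']
      rfl

theorem sigmaVec_iterate_finrank [FiniteDimensional Fq F] (w : Fin r → F[X]) :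
    (sigmaVec (Fq := Fq) Φ F)^[Module.finrank Fq F] w =
      (sigmaMatrixPow Fq Φ (Module.finrank Fq F)).mulVec w := by
  rw [sigmaVec_iterate]
  congr 1
  · ext1 i j
    exact Polynomial.map_id
  · have h : ((sigmaHom Fq F ^ Module.finrank Fq F : F →ₐ[Fq] F) : F →+* F) = RingHom.id F := by
      ext x
      change (sigmaHom Fq F ^ Module.finrank Fq F) x = x
      rw [AlgHom.coe_pow]
      exact sigmaHom_iterate_finrank x
    rw [h]
    exact funext fun j => Polynomial.map_id

theorem sigmaVec_iterate_smul (n : ℕ) (c : L) (w : Fin r → L[X]) :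
    (sigmaVec (Fq := Fq) Φ L)^[n] (c • w) =
      (sigmaHom Fq L)^[n] c • (sigmaVec (Fq := Fq) Φ L)^[n] w :=
  semilinear_iterate_smul (sigmaVec_const_smul Φ) n c w

/-- Both sides are the trace of `y`: the indices `1, …, d` replace `0, …, d-1`, and `σ^d = 1` on
`F`. -/
theorem sum_sigma_iterate_sub [FiniteDimensional Fq F] (y : F) :
    ∑ i ∈ Finset.range (Module.finrank Fq F), (sigmaHom Fq F)^[Module.finrank Fq F - i] y =
      ∑ i ∈ Finset.range (Module.finrank Fq F), (sigmaHom Fq F)^[i] y := by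
  have h1 := Finset.sum_range_reflect (fun j => (sigmaHom Fq F)^[j + 1] y)
    (Module.finrank Fq F)
  have h2 := Finset.sum_range_succ' (fun j => (sigmaHom Fq F)^[j] y) (Module.finrank Fq F)
  rw [Finset.sum_range_succ, sigmaHom_iterate_finrank] at h2
  rw [add_right_cancel h2, ← h1]
  refine Finset.sum_congr rfl fun i hi => ?_
  have := Finset.mem_range.mp hi
  congr 2
  omega

theorem exists_algebraMap_eq_sum_sigma [FiniteDimensional Fq F] (y : F) :
    ∃ c : Fq, algebraMap Fq F c =
      ∑ i ∈ Finset.range (Module.finrank Fq F), (sigmaHom Fq F)^[i] y := by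
  apply mem_range_algebraMap_of_sigmaHom_eq
  rw [map_sum]
  have h2 := Finset.sum_range_succ' (fun j => (sigmaHom Fq F)^[j] y) (Module.finrank Fq F)
  rw [Finset.sum_range_succ, sigmaHom_iterate_finrank] at h2
  rw [add_right_cancel h2]
  exact Finset.sum_congr rfl fun i _ => (Function.iterate_succ_apply' _ _ _).symm

end SigmaPow

namespace TModule

open Module TensorProduct

variable {Fq : Type*} [Field Fq] [Fintype Fq] {F : Type*} [Field F] [Algebra Fq F]

section

variable {θ : F} {ℓ : ℕ} (E : TModule Fq F θ ℓ)

instance (L : Type*) [CommRing L] [Algebra Fq L] : Module Fq (E.Points L) :=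
  inferInstanceAs (Module Fq (Fin ℓ → L))

instance (L : Type*) [CommRing L] [Algebra Fq L] [Algebra F L] [IsScalarTower Fq F L] :
    IsScalarTower Fq Fq[X] (E.Points L) :=
  ⟨fun c a x => by
    rw [smul_points, smul_points, map_smul]
    rfl⟩

instance (L : Type*) [CommRing L] [Algebra Fq L] [Module.Finite Fq L] :
    Module.Finite Fq (E.Points L) :=
  inferInstanceAs (Module.Finite Fq (Fin ℓ → L))

end

variable [FiniteDimensional Fq F] {θ : F} {ℓ : ℕ} (E : TModule Fq F θ ℓ)
  {r : ℕ} (e : Basis (Fin r) F[X] E.DualMotive)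

/-- The matrix of `1 - σ^d` over `F[t]`. -/
def oneSubMatrix : Matrix (Fin r) (Fin r) F[X] :=
  1 - sigmaMatrixPow Fq (E.sigmaMatrix e) (finrank Fq F)

theorem oneSubMatrix_mulVec (w : Fin r → F[X]) : (E.oneSubMatrix e).mulVec w =
    w - (sigmaVec (Fq := Fq) (E.sigmaMatrix e) F)^[finrank Fq F] w := by
  rw [oneSubMatrix, Matrix.sub_mulVec, Matrix.one_mulVec, sigmaVec_iterate_finrank]

/-- The cokernel of `1 - σ^d`. -/
abbrev OneSubCoker : Type _ := (Fin r → F[X]) ⧸ LinearMap.range (E.oneSubMatrix e).mulVecLin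

theorem mk_oneSubCoker_eq_iff (v w : Fin r → F[X]) :
    (Submodule.Quotient.mk v : E.OneSubCoker e) = Submodule.Quotient.mk w ↔
      ∃ z, z - (sigmaVec (Fq := Fq) (E.sigmaMatrix e) F)^[finrank Fq F] z = v - w := by
  rw [Submodule.Quotient.eq, LinearMap.mem_range]
  simp only [Matrix.mulVecLin_apply, oneSubMatrix_mulVec]

/-- The sum `∑ σⁱ` over `i < d`. -/
def traceVec : (Fin r → F[X]) →+ (Fin r → F[X]) where
  toFun v := ∑ i ∈ Finset.range (finrank Fq F),
    (sigmaVec (Fq := Fq) (E.sigmaMatrix e) F)^[i] v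
  map_zero' := Finset.sum_eq_zero fun i _ => iterate_map_zero _ i
  map_add' v w := by
    rw [← Finset.sum_add_distrib]
    exact Finset.sum_congr rfl fun i _ => iterate_map_add _ i v w

theorem traceVec_apply (v : Fin r → F[X]) : E.traceVec e v =
    ∑ i ∈ Finset.range (finrank Fq F), (sigmaVec (Fq := Fq) (E.sigmaMatrix e) F)^[i] v := rfl

/-- Telescoping; hence the trace carries the image of `σ - 1` into that of `1 - σ^d`. -/
theorem traceVec_sigmaVec_sub (z : Fin r → F[X]) :
    E.traceVec e (sigmaVec (Fq := Fq) (E.sigmaMatrix e) F z - z) =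
      (sigmaVec (Fq := Fq) (E.sigmaMatrix e) F)^[finrank Fq F] z - z := by
  have h := Finset.sum_range_succ'
    (fun i => (sigmaVec (Fq := Fq) (E.sigmaMatrix e) F)^[i] z) (finrank Fq F)
  rw [Finset.sum_range_succ] at h
  rw [map_sub, traceVec_apply, traceVec_apply]
  simp only [← Function.iterate_succ_apply]
  simp only [Function.iterate_zero, id] at h
  rw [sub_eq_sub_iff_add_eq_add, ← h, add_comm]

theorem traceVec_base_smul (p : Fq[X]) (v : Fin r → F[X]) :
    E.traceVec e (p.map (algebraMap Fq F) • v) = p.map (algebraMap Fq F) • E.traceVec e v := by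
  rw [traceVec_apply, traceVec_apply, Finset.smul_sum]
  refine Finset.sum_congr rfl fun i hi => ?_
  clear hi
  induction i with
  | zero => rfl
  | succ i ih => rw [Function.iterate_succ_apply', ih, sigmaVec_base_smul,
      ← Function.iterate_succ_apply' (sigmaVec (Fq := Fq) (E.sigmaMatrix e) F)]

theorem exists_traceMap : ∃ f : E.Points F →ₗ[Fq] E.OneSubCoker e,
    ∀ v, f (E.toPoints e F v) = Submodule.Quotient.mk (E.traceVec e v) := by
  have hsurj := E.toPoints_surjective e (L := F)
  have hwell : ∀ v w, E.toPoints e F v = E.toPoints e F w →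
      (Submodule.Quotient.mk (E.traceVec e v) : E.OneSubCoker e) =
        Submodule.Quotient.mk (E.traceVec e w) := by
    intro v w h
    rw [← sub_eq_zero, ← map_sub, toPoints_eq_zero_iff] at h
    obtain ⟨z, hz⟩ := h
    rw [mk_oneSubCoker_eq_iff, ← map_sub, ← hz, traceVec_sigmaVec_sub]
    refine ⟨-z, ?_⟩
    rw [← zero_sub z, iterate_map_sub,
      iterate_map_zero]
    abel
  let f : E.Points F → E.OneSubCoker e := fun x =>
    Submodule.Quotient.mk (E.traceVec e (Function.surjInv hsurj x))
  have hf : ∀ v, f (E.toPoints e F v) = Submodule.Quotient.mk (E.traceVec e v) := fun v =>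
    hwell _ _ (Function.surjInv_eq hsurj _)
  refine ⟨{ toFun := f, map_add' := fun x y => ?_, map_smul' := fun c x => ?_ }, hf⟩
  · obtain ⟨v, rfl⟩ := hsurj x
    obtain ⟨w, rfl⟩ := hsurj y
    rw [← map_add, hf, hf, hf, map_add, Submodule.Quotient.mk_add]
  · obtain ⟨v, rfl⟩ := hsurj x
    have h1 : c • E.toPoints e F v =
        E.toPoints e F ((C c : Fq[X]).map (algebraMap Fq F) • v) := by
      rw [toPoints_base_smul, ← Polynomial.algebraMap_eq, IsScalarTower.algebraMap_smul]
    rw [h1, hf, hf, traceVec_base_smul, Submodule.Quotient.mk_smul, Polynomial.map_C,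
      RingHom.id_apply, ← Polynomial.algebraMap_eq, IsScalarTower.algebraMap_smul,
      algebraMap_smul]

theorem toPoints_sigmaVec_iterate (n : ℕ) (w : Fin r → F[X]) :
    E.toPoints e F ((sigmaVec (Fq := Fq) (E.sigmaMatrix e) F)^[n] w) = E.toPoints e F w := by
  induction n with
  | zero => rfl
  | succ n ih => rw [Function.iterate_succ_apply', toPoints_sigmaVec, ih]

theorem toPoints_const_smul {L : Type*} [Field L] [Algebra Fq L] [Algebra F L]
    [IsScalarTower Fq F L] (c : Fq) (w : Fin r → L[X]) :
    E.toPoints e L (algebraMap Fq L c • w) = c • E.toPoints e L w := by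
  have h1 : algebraMap Fq L c • w = (C c : Fq[X]).map (algebraMap Fq L) • w := by
    rw [Polynomial.map_C]
    exact funext fun j => Polynomial.smul_eq_C_mul _
  rw [h1, toPoints_base_smul, ← Polynomial.algebraMap_eq, IsScalarTower.algebraMap_smul]

/-- Extension of scalars of `E(F)` from `𝔽_q` to `F` gives the cokernel of `1 - σ^d`. -/
theorem exists_tensor_equiv : ∃ Θ : F ⊗[Fq] E.Points F ≃ₗ[F] E.OneSubCoker e,
    ∀ ξ, Θ ((xEnd Fq (E.Points F)).baseChange F ξ) = xEnd F (E.OneSubCoker e) (Θ ξ) := by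
  obtain ⟨f, hf⟩ := E.exists_traceMap e
  obtain ⟨T, a, ha⟩ := exists_sigma_dual (Fq := Fq) (RingHom.id F)
  simp only [RingHom.id_apply] at ha
  have hsurj := E.toPoints_surjective e (L := F)
  let Θ : F ⊗[Fq] E.Points F →ₗ[F] E.OneSubCoker e := f.liftBaseChange F
  have hΘ : ∀ c x, Θ (c ⊗ₜ x) = c • f x := fun c x => LinearMap.liftBaseChange_tmul ..
  -- The candidate inverse of `Θ`, built from dual elements `a b` for the powers of `σ` on `F`.
  let B : (Fin r → F[X]) →+ F ⊗[Fq] E.Points F := ∑ b ∈ T,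
    ((TensorProduct.mk Fq F (E.Points F) (a b)).toAddMonoidHom.comp (E.toPoints e F)).comp
      (DistribSMul.toAddMonoidHom _ b)
  have hB : ∀ v, B v = ∑ b ∈ T, a b ⊗ₜ[Fq] E.toPoints e F (b • v) := fun v => by
    simp only [B, AddMonoidHom.finsetSum_apply]
    rfl
  have hBker : ∀ v w, (Submodule.Quotient.mk v : E.OneSubCoker e) = Submodule.Quotient.mk w →
      B v = B w := by
    intro v w h
    obtain ⟨z, hz⟩ := (E.mk_oneSubCoker_eq_iff e v w).mp h
    rw [← sub_eq_zero, ← map_sub, ← hz, hB]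
    refine Finset.sum_eq_zero fun b _ => ?_
    have h1 := sigmaVec_iterate_smul (Fq := Fq) (E.sigmaMatrix e) (finrank Fq F) b z
    rw [sigmaHom_iterate_finrank] at h1
    rw [smul_sub, ← h1, map_sub, toPoints_sigmaVec_iterate, sub_self, tmul_zero]
  have hlift : ∀ ξ, ∃ v, Submodule.Quotient.mk v = Θ ξ ∧ B v = ξ := by
    intro ξ
    induction ξ using TensorProduct.induction_on with
    | zero => exact ⟨0, by simp, map_zero B⟩
    | add x y hx hy =>
      obtain ⟨v, hv, hv'⟩ := hx
      obtain ⟨w, hw, hw'⟩ := hy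
      exact ⟨v + w, by rw [Submodule.Quotient.mk_add, hv, hw, map_add], by rw [map_add, hv', hw']⟩
    | tmul c x =>
      obtain ⟨w, rfl⟩ := hsurj x
      refine ⟨c • E.traceVec e w, by rw [hΘ, hf]; rfl, ?_⟩
      -- `y σ^i(w) = σ^i(σ^(d-i)(y) w)`, and evaluation at points does not see the outer `σ^i`; only
      -- the trace of `y` remains.
      have h1 : ∀ y : F, E.toPoints e F (y • E.traceVec e w) =
          E.toPoints e F
            ((∑ i ∈ Finset.range (finrank Fq F), (sigmaHom Fq F)^[i] y) • w) := by
        intro y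
        rw [← sum_sigma_iterate_sub, traceVec_apply, Finset.smul_sum, map_sum, Finset.sum_smul,
          map_sum]
        refine Finset.sum_congr rfl fun i hi => ?_
        rw [← E.toPoints_sigmaVec_iterate e i (((sigmaHom Fq F)^[finrank Fq F - i] y) • w),
          sigmaVec_iterate_smul, ← Function.iterate_add_apply, Nat.add_sub_cancel' (Finset.mem_range.mp hi).le,
          sigmaHom_iterate_finrank]
      -- The trace of `y` lies in `𝔽_q`, so it can cross the tensor sign.
      have h2 : ∀ y : F, ∀ z : F, z ⊗ₜ[Fq] E.toPoints e F (y • E.traceVec e w) =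
          (z * ∑ i ∈ Finset.range (finrank Fq F), (sigmaHom Fq F)^[i] y) ⊗ₜ[Fq]
            E.toPoints e F w := by
        intro y z
        obtain ⟨k, hk⟩ := exists_algebraMap_eq_sum_sigma (Fq := Fq) y
        rw [h1, ← hk, toPoints_const_smul, tmul_smul, smul_tmul', Algebra.smul_def, mul_comm]
      rw [hB]
      simp only [← mul_smul, h2]
      rw [← sum_tmul]
      congr 1
      simp only [Finset.mul_sum]
      rw [Finset.sum_comm, Finset.sum_eq_single_of_mem 0 (Finset.mem_range.mpr finrank_pos)]
      · have h0 := ha 0 finrank_pos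
        rw [if_pos rfl] at h0
        simp only [Function.iterate_zero, id, ← mul_assoc] at h0 ⊢
        rw [← Finset.sum_mul, h0, one_mul]
      · intro i hi hi0
        have h0 := ha i (Finset.mem_range.mp hi)
        rw [if_neg hi0] at h0
        have h3 : ∀ b, (sigmaHom Fq F)^[i] (b * c) =
            (sigmaHom Fq F)^[i] b * (sigmaHom Fq F)^[i] c := fun b => by
          rw [← AlgHom.coe_pow, map_mul]
        simp only [h3, ← mul_assoc]
        rw [← Finset.sum_mul, h0, zero_mul]
  have hinj : Function.Injective Θ := by
    intro ξ ξ' h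
    obtain ⟨v, hv, hv'⟩ := hlift ξ
    obtain ⟨w, hw, hw'⟩ := hlift ξ'
    rw [← hv', ← hw']
    exact hBker _ _ (hv.trans (h.trans hw.symm))
  have hΘsurj : Function.Surjective Θ := by
    intro q
    obtain ⟨v, rfl⟩ := Submodule.Quotient.mk_surjective _ q
    -- Duality recovers `v` from the traces of its multiples: `v = ∑ a_b Tr(b v)`.
    refine ⟨∑ b ∈ T, a b ⊗ₜ[Fq] E.toPoints e F (b • v), ?_⟩
    rw [map_sum]
    simp only [hΘ, hf, ← Submodule.Quotient.mk_smul, traceVec_apply, sigmaVec_iterate_smul]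
    have h1 : (∑ b ∈ T, (Submodule.Quotient.mk (a b • ∑ i ∈ Finset.range (finrank Fq F),
        (sigmaHom Fq F)^[i] b • (sigmaVec (Fq := Fq) (E.sigmaMatrix e) F)^[i] v) :
          E.OneSubCoker e)) = Submodule.Quotient.mk (∑ b ∈ T,
        (a b • ∑ i ∈ Finset.range (finrank Fq F),
        (sigmaHom Fq F)^[i] b • (sigmaVec (Fq := Fq) (E.sigmaMatrix e) F)^[i] v)) :=
      (map_sum (Submodule.mkQ _) _ _).symm
    rw [h1]
    congr 1
    simp only [Finset.smul_sum, ← mul_smul]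
    rw [Finset.sum_comm, Finset.sum_eq_single_of_mem 0 (Finset.mem_range.mpr finrank_pos)]
    · have h0 := ha 0 finrank_pos
      rw [if_pos rfl] at h0
      rw [← Finset.sum_smul, h0, one_smul]
      rfl
    · intro i hi hi0
      have h0 := ha i (Finset.mem_range.mp hi)
      rw [if_neg hi0] at h0
      rw [← Finset.sum_smul, h0, zero_smul]
  refine ⟨LinearEquiv.ofBijective Θ ⟨hinj, hΘsurj⟩, fun ξ => ?_⟩
  change Θ _ = (X : F[X]) • Θ ξ
  induction ξ using TensorProduct.induction_on with
  | zero => simp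
  | add x y hx hy => rw [map_add, map_add, hx, hy, map_add, smul_add]
  | tmul c x =>
    obtain ⟨w, rfl⟩ := hsurj x
    rw [LinearMap.baseChange_tmul, hΘ, hΘ]
    change c • f ((X : Fq[X]) • E.toPoints e F w) = _
    rw [← toPoints_base_smul, hf, hf, traceVec_base_smul, Polynomial.map_X,
      Submodule.Quotient.mk_smul, smul_comm]

theorem finite_oneSubCoker : FiniteDimensional F (E.OneSubCoker e) := by
  obtain ⟨Θ, -⟩ := E.exists_tensor_equiv e
  exact Module.Finite.equiv Θ

/-- The determinant of `1 - σ^d` on the dual `t`-motive is the order of `E(F)` up to a unit. -/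
theorem associated_det_oneSubMatrix :
    Associated (E.oneSubMatrix e).det
      ((xEnd Fq (E.Points F)).charpoly.map (algebraMap Fq F)) := by
  obtain ⟨Θ, hΘ⟩ := E.exists_tensor_equiv e
  have hfin := E.finite_oneSubCoker e
  rw [← charpoly_xEnd_of_baseChange Θ hΘ]
  exact associated_det_charpoly_quotient (E.oneSubMatrix e)

end TModule


/-! ### Torsion points and vectors fixed by `σ` modulo a polynomial -/

namespace TModule

open Module

variable {Fq : Type*} [Field Fq] [Fintype Fq] {F : Type*} [Field F] [Algebra Fq F]
  [Algebra.IsAlgebraic Fq F] {θ : F} {ℓ : ℕ} (E : TModule Fq F θ ℓ)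
  {r : ℕ} (e : Basis (Fin r) F[X] E.DualMotive)
  {L : Type*} [Field L] [Algebra Fq L] [Algebra.IsAlgebraic Fq L] [Algebra F L]
  [IsScalarTower Fq F L]

/-- The vector `w`, fixed by `σ` modulo `μ`, represents the `μ`-torsion point `x`. -/
def Represents (μ : Fq[X]) (x : E.Points L) (w : Fin r → L[X]) : Prop :=
  ∃ y, E.toPoints e L y = x ∧
    μ.map (algebraMap Fq L) • y = sigmaVec (Fq := Fq) (E.sigmaMatrix e) L w - w

variable {E e} {μ : Fq[X]}

theorem exists_represents {x : E.Points L} (hx : μ • x = 0) :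
    ∃ w, E.Represents e μ x w := by
  obtain ⟨y, rfl⟩ := E.toPoints_surjective e x
  rw [← toPoints_base_smul, toPoints_eq_zero_iff] at hx
  obtain ⟨w, hw⟩ := hx
  exact ⟨w, y, rfl, hw.symm⟩

theorem Represents.smul_eq_zero {x : E.Points L} {w : Fin r → L[X]} (h : E.Represents e μ x w) :
    μ • x = 0 := by
  obtain ⟨y, rfl, hy⟩ := h
  rw [← toPoints_base_smul, hy, map_sub, toPoints_sigmaVec, sub_self]

theorem Represents.add {x x' : E.Points L} {w w' : Fin r → L[X]} (h : E.Represents e μ x w)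
    (h' : E.Represents e μ x' w') : E.Represents e μ (x + x') (w + w') := by
  obtain ⟨y, rfl, hy⟩ := h
  obtain ⟨y', rfl, hy'⟩ := h'
  exact ⟨y + y', map_add _ _ _, by rw [smul_add, hy, hy', map_add]; abel⟩

theorem Represents.smul {x : E.Points L} {w : Fin r → L[X]} (a : Fq[X])
    (h : E.Represents e μ x w) :
    E.Represents e μ (a • x) (a.map (algebraMap Fq L) • w) := by
  obtain ⟨y, rfl, hy⟩ := h
  exact ⟨a.map (algebraMap Fq L) • y, toPoints_base_smul _ _ _ _, by
    rw [smul_comm, hy, sigmaVec_base_smul, smul_sub]⟩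

theorem Represents.zero : E.Represents e μ (0 : E.Points L) 0 :=
  ⟨0, map_zero _, by rw [smul_zero, map_zero, sub_zero]⟩

theorem Represents.sum {ι : Type*} (s : Finset ι) {x : ι → E.Points L} {w : ι → Fin r → L[X]}
    (h : ∀ i, E.Represents e μ (x i) (w i)) :
    E.Represents e μ (∑ i ∈ s, x i) (∑ i ∈ s, w i) := by
  classical
  induction s using Finset.induction_on with
  | empty => exact Represents.zero
  | insert i s hi ih => rw [Finset.sum_insert hi, Finset.sum_insert hi]; exact (h i).add ih

theorem Represents.sub {x x' : E.Points L} {w w' : Fin r → L[X]} (h : E.Represents e μ x w)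
    (h' : E.Represents e μ x' w') : E.Represents e μ (x - x') (w - w') := by
  have := h.add (h'.smul (-1))
  simpa [sub_eq_add_neg] using this

theorem Represents.map {x : E.Points L} {w : Fin r → L[X]} (h : E.Represents e μ x w)
    (g : L →ₐ[F] L) : E.Represents e μ (E.pointsMap g x) (vecMap (g : L →+* L) w) := by
  obtain ⟨y, rfl, hy⟩ := h
  refine ⟨vecMap (g : L →+* L) y, toPoints_map _ _ _ _, ?_⟩
  rw [sigmaVec_map_comm, ← map_sub, ← hy, vecMap_smul, Polynomial.map_map]
  congr 2
  exact ((g.restrictScalars Fq).comp_algebraMap).symm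

/-- The same vector serves for the torsion point one gets by multiplication, which lets a basis at
level `λ^(m+1)` be tested modulo `λ`. -/
theorem Represents.of_mul {ν : Fq[X]} {x : E.Points L} {w : Fin r → L[X]}
    (h : E.Represents e (μ * ν) x w) : E.Represents e μ (ν • x) w := by
  obtain ⟨y, rfl, hy⟩ := h
  refine ⟨ν.map (algebraMap Fq L) • y, toPoints_base_smul _ _ _ _, ?_⟩
  rw [← mul_smul, ← Polynomial.map_mul, hy]

theorem map_algebraMap_ne_zero (hμ : μ ≠ 0) : μ.map (algebraMap Fq L) ≠ 0 :=
  (Polynomial.map_ne_zero_iff (algebraMap Fq L).injective).mpr hμ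

/-- If the lift is `y = σz - z`, then `w - μz` is fixed by `σ`, hence zero. So the representing
vector is unique modulo `μ`. -/
theorem Represents.exists_eq_smul {w : Fin r → L[X]}
    (h : E.Represents e μ (0 : E.Points L) w) : ∃ z, w = μ.map (algebraMap Fq L) • z := by
  obtain ⟨y, hy0, hy⟩ := h
  obtain ⟨z, rfl⟩ := (E.toPoints_eq_zero_iff e).mp hy0
  refine ⟨z, sub_eq_zero.mp (E.sigmaVec_fixed_eq_zero e ?_)⟩
  rw [smul_sub] at hy
  rw [map_sub, sigmaVec_base_smul, ← sub_eq_zero]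
  linear_combination (exp := 1) -hy

theorem Represents.exists_sub_eq_smul {x : E.Points L} {w w' : Fin r → L[X]}
    (h : E.Represents e μ x w) (h' : E.Represents e μ x w') :
    ∃ z, w - w' = μ.map (algebraMap Fq L) • z := by
  have := h.sub h'
  rw [sub_self] at this
  exact this.exists_eq_smul

/-- Cancelling `μ` gives `y = σz - z`, which evaluates to zero: a point is determined by its vector
modulo `μ`. -/
theorem Represents.eq_zero (hμ : μ ≠ 0) {x : E.Points L} {z : Fin r → L[X]}
    (h : E.Represents e μ x (μ.map (algebraMap Fq L) • z)) : x = 0 := by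
  obtain ⟨y, rfl, hy⟩ := h
  rw [sigmaVec_base_smul, ← smul_sub] at hy
  rw [smul_right_injective _ (map_algebraMap_ne_zero hμ) hy, toPoints_eq_zero_iff]
  exact ⟨z, rfl⟩

/-- The vectors over `L[t]/μ`. -/
abbrev VecMod (L : Type*) [Field L] [Algebra Fq L] (r : ℕ) (μ : Fq[X]) : Type _ :=
  Fin r → L[X] ⧸ Ideal.span {μ.map (algebraMap Fq L)}

/-- Reduction of vectors modulo `μ`. -/
def vecMk (L : Type*) [Field L] [Algebra Fq L] (r : ℕ) (μ : Fq[X]) :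
    (Fin r → L[X]) →ₗ[L[X]] VecMod L r μ :=
  LinearMap.pi fun j => (Ideal.span {μ.map (algebraMap Fq L)}).mkQ ∘ₗ LinearMap.proj j

theorem vecMk_surjective : Function.Surjective (vecMk L r μ) := by
  intro v
  choose w hw using fun j => Ideal.Quotient.mk_surjective (v j)
  exact ⟨w, funext hw⟩

theorem vecMk_eq_iff {v w : Fin r → L[X]} :
    vecMk L r μ v = vecMk L r μ w ↔ ∃ z, v - w = μ.map (algebraMap Fq L) • z := by
  constructor
  · intro h
    have hj : ∀ j, μ.map (algebraMap Fq L) ∣ v j - w j := fun j => by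
      rw [← Ideal.mem_span_singleton]
      exact Ideal.Quotient.eq.mp (congrFun h j)
    choose z hz using hj
    exact ⟨z, funext hz⟩
  · rintro ⟨z, hz⟩
    refine funext fun j => Ideal.Quotient.eq.mpr ?_
    rw [Ideal.mem_span_singleton]
    exact ⟨z j, congrFun hz j⟩

theorem vecMk_const_smul (c : L) (w : Fin r → L[X]) :
    vecMk L r μ (c • w) = c • vecMk L r μ w := by
  rw [← IsScalarTower.algebraMap_smul L[X] c w, map_smul, IsScalarTower.algebraMap_smul]

variable (E e L μ) in
theorem exists_sigmaMod : ∃ φ : VecMod L r μ →+ VecMod L r μ,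
    (∀ w, φ (vecMk L r μ w) = vecMk L r μ (sigmaVec (Fq := Fq) (E.sigmaMatrix e) L w)) ∧
    ∀ (c : L) v, φ (c • v) = sigmaHom Fq L c • φ v := by
  have hs := vecMk_surjective (L := L) (r := r) (μ := μ)
  let φ : VecMod L r μ → VecMod L r μ := fun v =>
    vecMk L r μ (sigmaVec (Fq := Fq) (E.sigmaMatrix e) L (Function.surjInv hs v))
  have hφ : ∀ w, φ (vecMk L r μ w) =
      vecMk L r μ (sigmaVec (Fq := Fq) (E.sigmaMatrix e) L w) := by
    intro w
    obtain ⟨z, hz⟩ := vecMk_eq_iff.mp (Function.surjInv_eq hs (vecMk L r μ w))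
    refine vecMk_eq_iff.mpr ⟨sigmaVec (Fq := Fq) (E.sigmaMatrix e) L z, ?_⟩
    rw [← map_sub, hz, sigmaVec_base_smul]
  refine ⟨AddMonoidHom.mk' φ fun v w => ?_, hφ, fun c v => ?_⟩
  · obtain ⟨v, rfl⟩ := hs v
    obtain ⟨w, rfl⟩ := hs w
    rw [← map_add, hφ, hφ, hφ, map_add, map_add]
  · obtain ⟨v, rfl⟩ := hs v
    change φ _ = _ • φ _
    rw [← vecMk_const_smul, hφ, hφ, sigmaVec_const_smul, vecMk_const_smul]

/-! ### Torsion over an algebraically closed field, away from the characteristic -/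

section Closed

variable [FiniteDimensional Fq F] [IsAlgClosed L] {lam : Fq[X]}

theorem finite_range_vecMk (hlam : lam ≠ 0) :
    (Set.range fun v : Fin r → F[X] => vecMk L r lam (vecMap (algebraMap F L) v)).Finite := by
  have : Finite F := Module.finite_of_finite Fq
  have hF : lam.map (algebraMap Fq F) ≠ 0 := map_algebraMap_ne_zero hlam
  have := finiteDimensional_quotient_span hF
  have : Finite (F[X] ⧸ Ideal.span {lam.map (algebraMap Fq F)}) := Module.finite_of_finite F
  let I : Ideal L[X] := Ideal.span {lam.map (algebraMap Fq L)}
  let g : F[X] →+* L[X] ⧸ I := (Ideal.Quotient.mk I).comp (mapRingHom (algebraMap F L))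
  have hg : ∀ a ∈ Ideal.span {lam.map (algebraMap Fq F)}, g a = 0 := by
    intro a ha
    obtain ⟨b, rfl⟩ := Ideal.mem_span_singleton.mp ha
    refine Ideal.Quotient.eq_zero_iff_mem.mpr (Ideal.mem_span_singleton.mpr ?_)
    rw [coe_mapRingHom, Polynomial.map_mul, Polynomial.map_map, ← IsScalarTower.algebraMap_eq]
    exact dvd_mul_right _ _
  have hfin : (Set.range g).Finite := by
    refine (Set.finite_range (Ideal.Quotient.lift _ g hg)).subset ?_
    rintro _ ⟨a, rfl⟩
    exact ⟨Ideal.Quotient.mk _ a, Ideal.Quotient.lift_mk _ _ _⟩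
  refine (Set.Finite.pi' fun _ : Fin r => hfin).subset ?_
  rintro _ ⟨v, rfl⟩ j
  exact ⟨v j, rfl⟩

/-- The image of `F[t]^r` modulo `λ` is finite and spans over `L`. As `λ(θ) ≠ 0`, `σ` maps it onto
itself, so it permutes it and descent applies. -/
theorem span_sigmaMod_fixed (hlam : lam ≠ 0) (hθ : aeval θ lam ≠ 0)
    {φ : VecMod L r lam →+ VecMod L r lam}
    (hφ : ∀ w, φ (vecMk L r lam w) =
      vecMk L r lam (sigmaVec (Fq := Fq) (E.sigmaMatrix e) L w))
    (hsemi : ∀ (c : L) v, φ (c • v) = sigmaHom Fq L c • φ v) :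
    Submodule.span L {v | φ v = v} = ⊤ := by
  let S : Set (VecMod L r lam) :=
    Set.range fun v : Fin r → F[X] => vecMk L r lam (vecMap (algebraMap F L) v)
  have hSfin : Finite S := finite_range_vecMk (F := F) hlam
  have hS : ∀ v ∈ S, φ v ∈ S := by
    rintro _ ⟨v, rfl⟩
    exact ⟨sigmaVec (Fq := Fq) (E.sigmaMatrix e) F v, by rw [hφ, sigmaVec_vecMap]⟩
  let φ₀ : S → S := fun v => ⟨φ v.1, hS v.1 v.2⟩
  have hsurj : Function.Surjective φ₀ := by
    rintro ⟨_, v, rfl⟩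
    obtain ⟨v', v'', hv⟩ := E.exists_eq_sigmaVec_add e hθ v
    refine ⟨⟨_, v', rfl⟩, Subtype.ext ?_⟩
    change φ (vecMk L r lam _) = vecMk L r lam _
    rw [hφ, sigmaVec_vecMap, eq_comm, vecMk_eq_iff]
    refine ⟨vecMap (algebraMap F L) v'', ?_⟩
    rw [hv, map_add, add_sub_cancel_left, vecMap_smul, Polynomial.map_map,
      ← IsScalarTower.algebraMap_eq]
  refine span_fixed_eq_top hsemi (fun v : S => v.1) φ₀
    (Finite.injective_iff_surjective.mpr hsurj) (fun _ => rfl) ?_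
  rw [eq_top_iff]
  rintro v -
  obtain ⟨w, rfl⟩ := vecMk_surjective v
  induction w using vec_induction (algebraMap F L) with
  | zero => rw [map_zero]; exact zero_mem _
  | add v w hv hw => rw [map_add]; exact add_mem hv hw
  | smul c v =>
    rw [vecMk_const_smul]
    exact Submodule.smul_mem _ _ (Submodule.subset_span ⟨⟨_, v, rfl⟩, rfl⟩)

variable (E) in
-- Since `σ - 1` is onto modulo `λ`, a lift `w` of `x` equals `(σ-1)w' - λz`, so `x` is `λ` times
-- the point of `-z`.
theorem exists_smul_points_eq (hlam : lam ≠ 0) (hθ : aeval θ lam ≠ 0)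
    (e : Basis (Fin r) F[X] E.DualMotive) (x : E.Points L) :
    ∃ x', lam • x' = x := by
  obtain ⟨w, rfl⟩ := E.toPoints_surjective e x
  obtain ⟨φ, hφ, hsemi⟩ := exists_sigmaMod E e L lam
  obtain ⟨v, hv⟩ := exists_sub_eq_of_span_fixed hsemi (span_sigmaMod_fixed hlam hθ hφ hsemi)
    (vecMk L r lam w)
  obtain ⟨w', rfl⟩ := vecMk_surjective v
  rw [hφ, ← map_sub, vecMk_eq_iff] at hv
  obtain ⟨z, hz⟩ := hv
  refine ⟨E.toPoints e L (-z), ?_⟩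
  rw [← toPoints_base_smul, smul_neg, ← hz, map_neg, map_sub, map_sub, toPoints_sigmaVec]
  abel

/-- An `𝔽_q`-basis of the fixed vectors is an `L`-basis of the whole space, whose dimension is `r
deg λ`. -/
theorem card_fixed_vecMod (hlam : lam ≠ 0) (hθ : aeval θ lam ≠ 0)
    {φ : VecMod L r lam →+ VecMod L r lam}
    (hφ : ∀ w, φ (vecMk L r lam w) =
      vecMk L r lam (sigmaVec (Fq := Fq) (E.sigmaMatrix e) L w))
    (hsemi : ∀ (c : L) v, φ (c • v) = sigmaHom Fq L c • φ v) :
    Nat.card {v // φ v = v} = Fintype.card Fq ^ (r * lam.natDegree) := by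
  let W : Submodule Fq (VecMod L r lam) :=
    { carrier := {v | φ v = v}
      zero_mem' := map_zero φ
      add_mem' := fun {v w} hv hw => by
        change φ (v + w) = v + w
        rw [map_add, show φ v = v from hv, show φ w = w from hw]
      smul_mem' := fun c v hv => by
        change φ (c • v) = c • v
        rw [← algebraMap_smul L c v, hsemi, AlgHom.commutes, show φ v = v from hv] }
  have hdeg : (lam.map (algebraMap Fq L)).natDegree = lam.natDegree := natDegree_map _
  have hne : lam.map (algebraMap Fq L) ≠ 0 := map_algebraMap_ne_zero hlam
  have hfd := finiteDimensional_quotient_span hne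
  have hrank : finrank L (VecMod L r lam) = r * lam.natDegree := by
    rw [Module.finrank_pi_fintype, Finset.sum_const, Finset.card_univ, Fintype.card_fin,
      finrank_quotient_span_eq_natDegree, hdeg, smul_eq_mul]
  let b := Basis.ofVectorSpace Fq W
  have hliq : LinearIndependent Fq (fun i => (b i : VecMod L r lam)) :=
    b.linearIndependent.map' W.subtype W.ker_subtype
  have hli : LinearIndependent L (fun i => (b i : VecMod L r lam)) :=
    linearIndependent_of_fixed hsemi (fun i => (b i).2) hliq
  have hsp : ⊤ ≤ Submodule.span L (Set.range fun i => (b i : VecMod L r lam)) := by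
    rw [← span_sigmaMod_fixed hlam hθ hφ hsemi, Submodule.span_le]
    intro v hv
    have hmem : (⟨v, hv⟩ : W) ∈ Submodule.span Fq (Set.range b) := by rw [b.span_eq]; trivial
    have h2 := Submodule.mem_map_of_mem (f := W.subtype) hmem
    rw [Submodule.map_span, ← Set.range_comp] at h2
    exact Submodule.span_le_restrictScalars Fq L _ h2
  have hcard := (finrank_eq_nat_card_basis b).trans
    (finrank_eq_nat_card_basis (Basis.mk hli hsp)).symm
  have hfin : Module.Finite Fq W := by
    have : Finite (Basis.ofVectorSpaceIndex Fq W) := hli.finite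
    exact Module.Finite.of_basis b
  change Nat.card W = _
  rw [Module.natCard_eq_pow_finrank (K := Fq), Nat.card_eq_fintype_card, hcard, hrank]

theorem card_torsion_points (hlam : lam ≠ 0) (hθ : aeval θ lam ≠ 0)
    (e : Basis (Fin r) F[X] E.DualMotive) :
    Nat.card (Submodule.torsionBy Fq[X] (E.Points L) lam) =
      Fintype.card Fq ^ (r * lam.natDegree) := by
  obtain ⟨φ, hφ, hsemi⟩ := exists_sigmaMod E e L lam
  rw [← card_fixed_vecMod hlam hθ hφ hsemi]
  choose w hw using fun x : Submodule.torsionBy Fq[X] (E.Points L) lam =>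
    exists_represents (e := e) (μ := lam) x.2
  have hfix : ∀ x, φ (vecMk L r lam (w x)) = vecMk L r lam (w x) := fun x => by
    obtain ⟨y, -, hy⟩ := hw x
    rw [hφ, vecMk_eq_iff]
    exact ⟨y, hy.symm⟩
  refine Nat.card_congr (Equiv.ofBijective (fun x => ⟨vecMk L r lam (w x), hfix x⟩) ⟨?_, ?_⟩)
  · intro x x' h
    obtain ⟨z, hz⟩ := vecMk_eq_iff.mp (congrArg Subtype.val h)
    have h2 := (hw x).sub (hw x')
    rw [hz] at h2
    exact Subtype.ext (sub_eq_zero.mp (h2.eq_zero hlam))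
  · rintro ⟨v, hv⟩
    obtain ⟨w', rfl⟩ := vecMk_surjective v
    rw [hφ, vecMk_eq_iff] at hv
    obtain ⟨y, hy⟩ := hv
    have hrep : E.Represents e lam (E.toPoints e L y) w' := ⟨y, rfl, hy.symm⟩
    refine ⟨⟨E.toPoints e L y, hrep.smul_eq_zero⟩, Subtype.ext ?_⟩
    exact vecMk_eq_iff.mpr ((hw _).exists_sub_eq_smul hrep)

variable (E L) in
-- `E[λ]` is a vector space over the field `A/λ` of `q^(deg λ)` elements and has `q^(r deg λ)`
-- points, so its dimension is `r`.
theorem exists_isTorsionBasis (hirr : Irreducible lam) (hθ : aeval θ lam ≠ 0)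
    (e : Basis (Fin r) F[X] E.DualMotive) :
    ∃ x : Fin r → E.Points L, IsTorsionBasis lam x := by
  let I : Ideal Fq[X] := Ideal.span {lam}
  have hmax : I.IsMaximal := PrincipalIdealRing.isMaximal_of_irreducible hirr
  let _ : Field (Fq[X] ⧸ I) := Ideal.Quotient.field I
  let N := Submodule.torsionBy Fq[X] (E.Points L) lam
  have htors : Module.IsTorsionBySet Fq[X] N (I : Set Fq[X]) := by
    rintro x ⟨a, ha⟩
    obtain ⟨b, rfl⟩ := Ideal.mem_span_singleton.mp ha
    apply Subtype.ext
    change (lam * b) • (x : E.Points L) = 0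
    rw [mul_comm, mul_smul]
    exact (congrArg (b • ·) x.2).trans (smul_zero b)
  let _ : Module (Fq[X] ⧸ I) N := htors.module
  have hsm : ∀ (a : Fq[X]) (x : N), (Ideal.Quotient.mk I a) • x = a • x := fun a x =>
    Module.IsTorsionBySet.mk_smul htors a x
  have hcard : Nat.card N = Fintype.card Fq ^ (r * lam.natDegree) :=
    card_torsion_points hirr.ne_zero hθ e
  have hq : 1 < Fintype.card Fq := Fintype.one_lt_card
  have hfinN : Finite N := Nat.finite_of_card_ne_zero (by
    rw [hcard]; exact pow_ne_zero _ (zero_lt_one.trans hq).ne')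
  have hfd := finiteDimensional_quotient_span hirr.ne_zero
  have hfinN' : Module.Finite (Fq[X] ⧸ I) N := Module.Finite.of_finite
  have hcardk : Nat.card (Fq[X] ⧸ I) = Fintype.card Fq ^ lam.natDegree := by
    rw [Module.natCard_eq_pow_finrank (K := Fq), Nat.card_eq_fintype_card,
      finrank_quotient_span_eq_natDegree]
  have hrank : finrank (Fq[X] ⧸ I) N = r := by
    have h1 := Module.natCard_eq_pow_finrank (K := Fq[X] ⧸ I) (V := N)
    rw [hcard, hcardk, ← pow_mul] at h1
    have h2 := Nat.pow_right_injective hq h1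
    rw [mul_comm] at h2
    exact (Nat.eq_of_mul_eq_mul_left hirr.natDegree_pos h2).symm
  let b := finBasisOfFinrankEq (Fq[X] ⧸ I) N hrank
  refine ⟨fun j => b j, fun j => (b j).2, fun a ha j => ?_, fun z hz => ?_⟩
  · have h1 : ∑ j, Ideal.Quotient.mk I (a j) • b j = 0 := by
      simp only [hsm]
      apply Subtype.ext
      rw [Submodule.coe_sum]
      exact ha
    have h2 := Fintype.linearIndependent_iff.mp b.linearIndependent _ h1 j
    exact Ideal.mem_span_singleton.mp (Ideal.Quotient.eq_zero_iff_mem.mp h2)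
  · choose a ha using fun j => Ideal.Quotient.mk_surjective (b.repr ⟨z, hz⟩ j)
    refine ⟨a, ?_⟩
    have h1 := b.sum_repr ⟨z, hz⟩
    simp only [← ha, hsm] at h1
    have h2 := congrArg Subtype.val h1
    rw [Submodule.coe_sum] at h2
    exact h2.symm

/-- Vectors representing a basis of the `λ`-torsion form a matrix which is invertible
modulo `λ`. -/
theorem isCoprime_det_of_represents (hlam : lam ≠ 0) (hθ : aeval θ lam ≠ 0)
    {x : Fin r → E.Points L} (hx : IsTorsionBasis lam x) (w : Fin r → Fin r → L[X])
    (hw : ∀ j, E.Represents e lam (x j) (w j)) :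
    IsCoprime (Matrix.of fun i j => w j i).det (lam.map (algebraMap Fq L)) := by
  obtain ⟨φ, hφ, hsemi⟩ := exists_sigmaMod E e L lam
  let I : Ideal L[X] := Ideal.span {lam.map (algebraMap Fq L)}
  let U : Submodule L[X] (VecMod L r lam) :=
    Submodule.span L[X] (Set.range fun j => vecMk L r lam (w j))
  -- A fixed vector represents a `λ`-torsion point, and expanding that point in the basis `x`
  -- expands the vector modulo `λ`.
  have hfix : ∀ v, φ v = v → v ∈ U := by
    intro v hv
    obtain ⟨w', rfl⟩ := vecMk_surjective v
    rw [hφ, vecMk_eq_iff] at hv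
    obtain ⟨y, hy⟩ := hv
    have hrep : E.Represents e lam (E.toPoints e L y) w' := ⟨y, rfl, hy.symm⟩
    obtain ⟨a, ha⟩ := hx.span _ hrep.smul_eq_zero
    have hrep' := Represents.sum Finset.univ fun j => (hw j).smul (a j)
    rw [← ha] at hrep'
    rw [vecMk_eq_iff.mpr (hrep.exists_sub_eq_smul hrep'), map_sum]
    refine Submodule.sum_mem _ fun j _ => ?_
    rw [map_smul]
    exact Submodule.smul_mem _ _ (Submodule.subset_span ⟨j, rfl⟩)
  have htop : ∀ v, v ∈ U := by
    intro v
    have hv : v ∈ Submodule.span L {v | φ v = v} := by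
      rw [span_sigmaMod_fixed hlam hθ hφ hsemi]; trivial
    induction hv using Submodule.span_induction with
    | mem v hv => exact hfix v hv
    | zero => exact zero_mem _
    | add v w _ _ hv hw => exact add_mem hv hw
    | smul c v _ hv =>
      rw [← IsScalarTower.algebraMap_smul L[X] c v]
      exact Submodule.smul_mem _ _ hv
  -- Since the columns generate, the matrix has a right inverse modulo `λ`, so its determinant is a
  -- unit there.
  choose c hc using fun j : Fin r =>
    (Submodule.mem_span_range_iff_exists_fun L[X]).mp (htop (vecMk L r lam (Pi.single j 1)))
  let q : L[X] →+* L[X] ⧸ I := Ideal.Quotient.mk I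
  have hmul : q.mapMatrix (Matrix.of fun i j => w j i) * q.mapMatrix (Matrix.of fun i j => c j i)
      = 1 := by
    rw [← map_mul]
    ext1 i j
    have h1 := congrFun (hc j) i
    simp only [← map_smul, ← map_sum] at h1
    have h2 : q ((∑ k, c j k • w k) i) = q ((Pi.single j 1 : Fin r → L[X]) i) := h1
    rw [RingHom.mapMatrix_apply, Matrix.map_apply, Matrix.mul_apply]
    simp only [Matrix.of_apply]
    rw [Finset.sum_apply] at h2
    simp only [Pi.smul_apply, smul_eq_mul] at h2
    simp only [mul_comm (w _ _)]
    rw [h2, Matrix.one_apply, Pi.single_apply]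
    split_ifs
    · exact map_one q
    · exact map_zero q
  have hdet := congrArg Matrix.det hmul
  rw [Matrix.det_mul, Matrix.det_one, ← RingHom.map_det, ← RingHom.map_det, ← map_mul,
    ← map_one q, Ideal.Quotient.eq, Ideal.mem_span_singleton] at hdet
  obtain ⟨z, hz⟩ := hdet
  exact ⟨(Matrix.of fun i j => c j i).det, -z, by linear_combination hz⟩

end Closed

end TModule


/-! ### Frobenius on the Tate module -/

namespace TModule

open Module

variable {Fq : Type*} [Field Fq] [Fintype Fq] {F : Type*} [Field F] [Algebra Fq F]
  [FiniteDimensional Fq F] {θ : F} {ℓ : ℕ} {E : TModule Fq F θ ℓ}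
  {r : ℕ} {e : Basis (Fin r) F[X] E.DualMotive}
  {L : Type*} [Field L] [Algebra Fq L] [Algebra.IsAlgebraic Fq L] [Algebra F L]
  [IsScalarTower Fq F L]

theorem exists_iterate_sub_eq_smul {μ : Fq[X]} {w : Fin r → L[X]}
    (hw : ∃ y, sigmaVec (Fq := Fq) (E.sigmaMatrix e) L w - w = μ.map (algebraMap Fq L) • y)
    (n : ℕ) :
    ∃ y, (sigmaVec (Fq := Fq) (E.sigmaMatrix e) L)^[n] w - w =
      μ.map (algebraMap Fq L) • y := by
  obtain ⟨y₀, hy₀⟩ := hw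
  induction n with
  | zero => exact ⟨0, by simp⟩
  | succ n ih =>
    obtain ⟨y, hy⟩ := ih
    refine ⟨sigmaVec (Fq := Fq) (E.sigmaMatrix e) L y + y₀, ?_⟩
    rw [smul_add, ← sigmaVec_base_smul, ← hy, ← hy₀, Function.iterate_succ_apply', map_sub]
    abel

/-- Modulo `μ`, `w ≡ σ^d(w) = Ψ w^(σ^d)`. Applying `g = τ^d` to coefficients fixes `Ψ` and `μ` and
cancels the twist of `w`. -/
theorem Represents.mulVec_sub_map {μ : Fq[X]} {x : E.Points L} {w : Fin r → L[X]}
    (h : E.Represents e μ x w) (g : L →ₐ[F] L)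
    (hg : ∀ c, g c = c ^ Fintype.card Fq ^ finrank Fq F) :
    ∃ z, ((sigmaMatrixPow Fq (E.sigmaMatrix e) (finrank Fq F)).map
        (Polynomial.map (algebraMap F L))).mulVec w - vecMap (g : L →+* L) w =
      μ.map (algebraMap Fq L) • z := by
  obtain ⟨y, -, hy⟩ := h
  obtain ⟨z, hz⟩ := exists_iterate_sub_eq_smul ⟨y, hy.symm⟩ (finrank Fq F)
  refine ⟨vecMap (g : L →+* L) z, ?_⟩
  have h1 := congrArg (vecMap (g : L →+* L)) hz
  rw [map_sub, sigmaVec_iterate, vecMap_mulVec, vecMap_vecMap, vecMap_smul,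
    Polynomial.map_map] at h1
  have h2 : (g : L →+* L).comp ((sigmaHom Fq L ^ finrank Fq F : L →ₐ[Fq] L) : L →+* L) =
      RingHom.id L := by
    ext c
    change g ((sigmaHom Fq L ^ finrank Fq F) c) = c
    rw [hg, sigmaHom_pow_pow_card]
  have h3 : (g : L →+* L).comp (algebraMap Fq L) = algebraMap Fq L :=
    (g.restrictScalars Fq).comp_algebraMap
  have h4 : vecMap (RingHom.id L) w = w := funext fun _ => Polynomial.map_id
  have h5 : ((sigmaMatrixPow Fq (E.sigmaMatrix e) (finrank Fq F)).map
      (Polynomial.map (algebraMap F L))).map (Polynomial.map (g : L →+* L)) =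
      (sigmaMatrixPow Fq (E.sigmaMatrix e) (finrank Fq F)).map
        (Polynomial.map (algebraMap F L)) := by
    ext1 i j
    rw [Matrix.map_apply, Matrix.map_apply, Polynomial.map_map]
    congr 1
    exact g.comp_algebraMap
  rwa [h2, h3, h4, h5] at h1

theorem map_det_matrix {K K' : Type*} [Field K] [Field K'] (g : K →+* K')
    (S : Matrix (Fin r) (Fin r) K[X]) :
    S.det.map g = (S.map (Polynomial.map g)).det :=
  RingHom.map_det (mapRingHom g) S

/-- The matrix of the Frobenius on `λᵐ`-torsion points and the matrix of `σ^d` on the dual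
`t`-motive give the same determinant modulo `λᵐ`. -/
theorem pow_dvd_det_sub_det [IsAlgClosed L] {lam : Fq[X]} (hlam : lam ≠ 0)
    (hθ : aeval θ lam ≠ 0) (g : L →ₐ[F] L)
    (hg : ∀ c, g c = c ^ Fintype.card Fq ^ finrank Fq F)
    {x : Fin r → E.Points L} (hx : IsTorsionBasis lam x) (m : ℕ) (y : Fin r → E.Points L)
    (hy : ∀ j, lam ^ (m + 1) • y j = 0) (hyx : ∀ j, lam ^ m • y j = x j)
    (b : Matrix (Fin r) (Fin r) Fq[X])
    (hb : ∀ j, E.pointsMap g (y j) = ∑ i, b i j • y i) :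
    (lam ^ (m + 1)).map (algebraMap Fq L) ∣
      (E.oneSubMatrix e).det.map (algebraMap F L) - (1 - b).det.map (algebraMap Fq L) := by
  choose w hw using fun j => exists_represents (e := e) (hy j)
  let V : Matrix (Fin r) (Fin r) L[X] := Matrix.of fun i j => w j i
  have hcop : IsCoprime ((lam ^ (m + 1)).map (algebraMap Fq L)) V.det := by
    rw [Polynomial.map_pow]
    refine IsCoprime.pow_left (isCoprime_det_of_represents (e := e) hlam hθ hx w fun j => ?_).symm
    have h := hw j
    rw [pow_succ'] at h
    rw [← hyx]
    exact h.of_mul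
  let Ψ : Matrix (Fin r) (Fin r) L[X] :=
    (sigmaMatrixPow Fq (E.sigmaMatrix e) (finrank Fq F)).map (Polynomial.map (algebraMap F L))
  let β : Matrix (Fin r) (Fin r) L[X] := b.map (Polynomial.map (algebraMap Fq L))
  -- Both `Ψ w_j` and `∑ b_ij w_i` are congruent to `w_j^(τ^d)`: the first by the action of `σ^d`,
  -- the second because it represents the same point.
  have hdvd : ∀ i j, (lam ^ (m + 1)).map (algebraMap Fq L) ∣ (Ψ * V) i j - (V * β) i j := by
    intro i j
    obtain ⟨z, hz⟩ := (hw j).mulVec_sub_map g hg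
    have h1 : E.Represents e (lam ^ (m + 1)) (E.pointsMap g (y j))
        (∑ i, (b i j).map (algebraMap Fq L) • w i) := by
      rw [hb]
      exact Represents.sum Finset.univ fun i => (hw i).smul (b i j)
    obtain ⟨z', hz'⟩ := ((hw j).map g).exists_sub_eq_smul h1
    refine ⟨z i + z' i, ?_⟩
    have h2 := congrFun hz i
    have h3 := congrFun hz' i
    rw [Pi.sub_apply, Pi.smul_apply, smul_eq_mul] at h2 h3
    rw [Finset.sum_apply] at h3
    have h4 : (V * β) i j =
        ∑ k, ((b k j).map (algebraMap Fq L) • w k) i := by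
      rw [Matrix.mul_apply]
      exact Finset.sum_congr rfl fun k _ => mul_comm _ _
    have h5 : (Ψ * V) i j = Ψ.mulVec (w j) i := rfl
    rw [h4, h5, mul_add, ← h2, ← h3]
    ring
  let I : Ideal L[X] := Ideal.span {(lam ^ (m + 1)).map (algebraMap Fq L)}
  let q : L[X] →+* L[X] ⧸ I := Ideal.Quotient.mk I
  have hmat : q.mapMatrix ((1 - Ψ) * V) = q.mapMatrix (V * (1 - β)) := by
    rw [sub_mul, mul_sub, one_mul, mul_one, map_sub, map_sub, sub_right_inj]
    ext1 i j
    exact Ideal.Quotient.eq.mpr (Ideal.mem_span_singleton.mpr (hdvd i j))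
  have hdet := congrArg Matrix.det hmat
  rw [← RingHom.map_det, ← RingHom.map_det, Ideal.Quotient.eq, Ideal.mem_span_singleton,
    Matrix.det_mul, Matrix.det_mul, mul_comm V.det, ← sub_mul] at hdet
  have h1 : (E.oneSubMatrix e).det.map (algebraMap F L) = (1 - Ψ).det := by
    rw [map_det_matrix, oneSubMatrix, Matrix.map_sub _ fun _ _ => Polynomial.map_sub _,
      Matrix.map_one _ (Polynomial.map_zero _) (Polynomial.map_one _)]
  have h2 : (1 - b).det.map (algebraMap Fq L) = (1 - β).det := by
    rw [map_det_matrix, Matrix.map_sub _ fun _ _ => Polynomial.map_sub _,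
      Matrix.map_one _ (Polynomial.map_zero _) (Polynomial.map_one _)]
  rw [h1, h2]
  -- The factor `det V` cancels because it is prime to `λ`.
  exact hcop.dvd_of_dvd_mul_right hdet

/-- A scalar multiple of a polynomial over `𝔽_q` which is congruent modulo all powers of `λ` to
polynomials over `𝔽_q` is defined over `𝔽_q`. -/
theorem exists_algebraMap_eq_of_pow_dvd {lam h : Fq[X]} (hirr : Irreducible lam) (hh : h ≠ 0)
    (c : L) (p : ℕ → Fq[X])
    (hp : ∀ m, (lam ^ (m + 1)).map (algebraMap Fq L) ∣
      C c * h.map (algebraMap Fq L) - (p m).map (algebraMap Fq L)) :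
    ∃ a : Fq, algebraMap Fq L a = c := by
  apply mem_range_algebraMap_of_sigmaHom_eq
  by_contra hne
  have h0 : (sigmaHom Fq L : L →+* L).comp (algebraMap Fq L) = algebraMap Fq L :=
    (sigmaHom Fq L).comp_algebraMap
  -- Exponent `deg h + 1` suffices: `λ^(deg h + 1)` divides `(σ(c) - c) h`, whose degree is too
  -- small unless the constant is zero.
  obtain ⟨z, hz⟩ := hp h.natDegree
  have hz' := congrArg (Polynomial.map (sigmaHom Fq L : L →+* L)) hz
  rw [Polynomial.map_sub, Polynomial.map_mul, Polynomial.map_mul, Polynomial.map_C,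
    Polynomial.map_map, Polynomial.map_map, Polynomial.map_map, h0, RingHom.coe_coe] at hz'
  have hd : (lam ^ (h.natDegree + 1)).map (algebraMap Fq L) ∣
      C (sigmaHom Fq L c - c) * h.map (algebraMap Fq L) :=
    ⟨z.map (sigmaHom Fq L : L →+* L) - z, by
      rw [C_sub]; linear_combination hz' - hz⟩
  have hdeg := natDegree_le_of_dvd hd (mul_ne_zero (C_ne_zero.mpr (sub_ne_zero.mpr hne))
    (map_algebraMap_ne_zero hh))
  rw [natDegree_C_mul (sub_ne_zero.mpr hne), natDegree_map, natDegree_map, natDegree_pow] at hdeg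
  have := hirr.natDegree_pos
  nlinarith

/-- The value at `1` of the characteristic polynomial of the Frobenius is a constant multiple of
the order of the rational points. -/
theorem exists_charpoly_eval_one_eq [IsAlgClosed L] {lam : Fq[X]} (hirr : Irreducible lam)
    (hθ : aeval θ lam ≠ 0) (e : Basis (Fin r) F[X] E.DualMotive) (g : L →ₐ[F] L)
    (hg : ∀ c, g c = c ^ Fintype.card Fq ^ finrank Fq F) :
    ∃ (_ : Basis (Fin r) (LamCompletion lam) (TateModule lam (E.Points L)))
      (_ : Module.Free (LamCompletion lam) (TateModule lam (E.Points L)))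
      (_ : Module.Finite (LamCompletion lam) (TateModule lam (E.Points L))) (a : Fqˣ),
      algebraMap Fq[X] (LamCompletion lam) (C (a : Fq) * (xEnd Fq (E.Points F)).charpoly) =
        (tateMap lam (E.pointsMap g)).charpoly.eval 1 := by
  obtain ⟨x, hx⟩ := E.exists_isTorsionBasis L hirr hθ e
  obtain ⟨y, hy⟩ := hx.exists_basis (E.exists_smul_points_eq hirr.ne_zero hθ e)
  have hfree := Module.Free.of_basis y
  have hfin := Module.Finite.of_basis y
  refine ⟨y, hfree, hfin, ?_⟩
  let B := LinearMap.toMatrix y y (tateMap lam (E.pointsMap g))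
  have hD : (tateMap lam (E.pointsMap g)).charpoly.eval 1 = (1 - B).det := by
    rw [← LinearMap.charpoly_toMatrix _ y, Matrix.eval_charpoly, map_one]
  choose b hb using fun (m : ℕ) (i j : Fin r) => exists_evalₐ_eq_mk m (B i j)
  have hDm : ∀ m, AdicCompletion.evalₐ (Ideal.span {lam}) m (1 - B).det =
      Ideal.Quotient.mk _ (1 - Matrix.of (b m)).det := by
    intro m
    rw [← AlgHom.coe_toRingHom, RingHom.map_det, RingHom.map_det, map_sub, map_sub, map_one,
      map_one]
    congr 2
    ext1 i j
    exact hb m i j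
  have hfrob : ∀ m j, E.pointsMap g ((y j).1 m).1 =
      ∑ i, (Matrix.of (b m)) i j • ((y i).1 m).1 := by
    intro m j
    refine Eq.trans ?_ (tate_sum_smul_apply (fun i => y i) (fun i => B i j) m
      (fun i => b m i j) fun i => hb m i j)
    have h1 : tateMap lam (E.pointsMap g) (y j) = ∑ i, B i j • y i := by
      conv_lhs => rw [← y.sum_repr (tateMap lam (E.pointsMap g) (y j))]
      simp only [B, LinearMap.toMatrix_apply]
    rw [← h1]
    rfl
  -- The points used are the level `m+1` components of the Tate basis, which `λ^m` sends to the
  -- basis `x` of `E[λ]`.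
  have hdvd : ∀ m, (lam ^ (m + 1)).map (algebraMap Fq L) ∣
      (E.oneSubMatrix e).det.map (algebraMap F L) -
        (1 - Matrix.of (b (m + 1))).det.map (algebraMap Fq L) := fun m =>
    pow_dvd_det_sub_det hirr.ne_zero hθ g hg hx m (fun j => ((y j).1 (m + 1)).1)
      (fun j => ((y j).1 (m + 1)).2)
      (fun j => by rw [← hy j, ← pow_smul_tate (y j) 1 m, add_comm 1 m])
      _ (hfrob (m + 1))
  let h : Fq[X] := (xEnd Fq (E.Points F)).charpoly
  have hh : h ≠ 0 := (LinearMap.charpoly_monic _).ne_zero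
  obtain ⟨u, hu⟩ := (E.associated_det_oneSubMatrix e).symm
  obtain ⟨c, hc, hcu⟩ := Polynomial.isUnit_iff.mp u.isUnit
  have hdet : (E.oneSubMatrix e).det.map (algebraMap F L) =
      C (algebraMap F L c) * h.map (algebraMap Fq L) := by
    rw [← hu, ← hcu, Polynomial.map_mul, Polynomial.map_C, Polynomial.map_map,
      ← IsScalarTower.algebraMap_eq, mul_comm]
  simp only [hdet] at hdvd
  -- The Smith form determines the constant only in `F^×`; the congruences with polynomials over
  -- `𝔽_q` force it into `𝔽_q`.
  obtain ⟨a, ha⟩ := exists_algebraMap_eq_of_pow_dvd hirr hh _ _ hdvd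
  have ha0 : a ≠ 0 := by
    rintro rfl
    rw [map_zero, eq_comm, map_eq_zero] at ha
    rw [ha] at hc
    exact not_isUnit_zero hc
  refine ⟨Units.mk0 a ha0, ?_⟩
  rw [hD]
  refine lamCompletion_ext fun m => ?_
  rw [AlgHom.commutes, hDm]
  refine Ideal.Quotient.eq.mpr ?_
  rw [Ideal.span_singleton_pow, Ideal.mem_span_singleton]
  -- Level `0` carries no condition; the congruence at level `m+1` descends from `L[t]` to `𝔽_q[t]`.
  rcases m with _ | m
  · rw [pow_zero]; exact one_dvd _
  · have h1 := hdvd m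
    rw [← ha, ← Polynomial.map_C, ← Polynomial.map_mul, ← Polynomial.map_sub] at h1
    exact (Polynomial.map_dvd_map' (algebraMap Fq L)).mp h1

end TModule

/-! ### The order formula -/

theorem aeval_ne_zero_of_ne {Fq F : Type*} [Field Fq] [Field F] [Algebra Fq F] {f lam : Fq[X]}
    (hf : f.Monic) (hf' : Irreducible f) (hlam : lam.Monic) (hirr : Irreducible lam)
    (hne : lam ≠ f) {θ : F} (hθ : aeval θ f = 0) : aeval θ lam ≠ 0 := fun h =>
  hne ((minpoly.eq_of_irreducible_of_monic hirr h hlam).trans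
    (minpoly.eq_of_irreducible_of_monic hf' hθ hf).symm)
end

theorem corollary3 {Fq : Type*} [Field Fq] [Fintype Fq]
    (f : Fq[X]) [Fact (Irreducible f)] (hf : f.Monic)
    (θ : AdjoinRoot f) (hθ : aeval θ f = 0)
    (ℓ : ℕ) (E : TModule Fq (AdjoinRoot f) θ ℓ) (hab : E.IsAbelian) (hfin : E.IsAFinite)
    (lam : Fq[X]) (hlam : lam.Monic) (hirr : Irreducible lam) (hne : lam ≠ f) :
    ∃ (_ : Module.Free (LamCompletion lam) (E.Tate lam))
      (_ : Module.Finite (LamCompletion lam) (E.Tate lam))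
      (P : Fq[X]),
      algebraMap Fq[X] (LamCompletion lam) P = (E.tateFrob lam).charpoly.eval 1 ∧
      ∃ γ : Fqˣ,
        (∀ h : Fq[X], IsModuleOrder (E.Points (AdjoinRoot f)) h ↔ h = C (γ : Fq) * P) ∧
        (∀ γ' : Fqˣ, (C (γ' : Fq) * P).Monic ↔ γ' = γ) := by
  have hf' : Irreducible f := Fact.out
  have hθ' : aeval θ lam ≠ 0 := aeval_ne_zero_of_ne hf hf' hlam hirr hne hθ
  have hdim : Module.finrank Fq (AdjoinRoot f) = f.natDegree := by
    rw [(AdjoinRoot.powerBasis hf'.ne_zero).finrank, AdjoinRoot.powerBasis_dim]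
  have halg : Algebra.IsAlgebraic Fq (AlgebraicClosure (AdjoinRoot f)) :=
    Algebra.IsAlgebraic.trans Fq (AdjoinRoot f) _
  obtain ⟨_, _⟩ := hfin
  let e := Module.finBasis (AdjoinRoot f)[X] E.DualMotive
  obtain ⟨_, hfree, hfinite, a, ha⟩ := TModule.exists_charpoly_eval_one_eq
    (L := AlgebraicClosure (AdjoinRoot f)) hirr hθ' e (frobF f) fun c => by
      rw [hdim]; exact tauHom_pow_apply Fq f.natDegree c
  -- The value at `1` is `a` times the monic order, so the normalising constant is `a⁻¹` and no
  -- other.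
  refine ⟨hfree, hfinite, C (a : Fq) * (xEnd Fq (E.Points (AdjoinRoot f))).charpoly, ha, a⁻¹,
    fun h => ?_, fun γ' => ?_⟩
  · rw [← mul_assoc, ← C_mul, ← Units.val_mul, inv_mul_cancel, Units.val_one, C_1, one_mul]
    exact ⟨fun hM => hM.eq_charpoly, fun hM => hM ▸ isModuleOrder_charpoly _⟩
  · rw [← mul_assoc, ← C_mul, ← Units.val_mul, Monic, leadingCoeff_mul, leadingCoeff_C,
      (LinearMap.charpoly_monic _).leadingCoeff, mul_one, Units.val_eq_one,
      mul_eq_one_iff_eq_inv]
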